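/- Let $p\neq 2$ be a prime, let $a\in\mathbb{Z}$ be a quadratic non-residue modulo $p$, and let $\alpha>0$, $\kappa>0$. Let $f^{\circ}(\xi)=ap\,\xi_1^2-p\,\xi_2^2-a\,\xi_3^2+\xi_4^2$ for $\xi\in\mathbb{Q}_p^4$, let $\|x\|_p=\max_{1\le i\le 4}|x_i|_p$ and $\xi\cdot x=\sum_{j=1}^4\xi_jx_j$, let $\chi(y)=e^{2\pi i\{y\}_p}$ for $y\in\mathbb{Q}_p$, where $\{y\}_p$ is the $p$-adic fractional part of $y$, and let $d^4x$ be the Haar measure on $\mathbb{Q}_p^4$ normalized so that $\mathbb{Z}_p^4$ has measure $1$. For $x\in\mathbb{Q}_p^4$ and $t>0$ let $$Z(x,t)=Z_t(x)=\int_{\mathbb{Q}_p^4}\chi(\xi\cdot x)\,e^{-\kappa t|f^{\circ}(\xi)|_p^{\alpha}}\,d^4\xi .$$ This integral converges absolutely and is a real number. Moreover: (i) There is a constant $C_1>0$, depending only on $p,a,\alpha,\kappa$, such that for all $x\in\mathbb{Q}_p^4$ and $t>0$ $$Z(x,t)\le C_1\,t\,\bigl(t^{1/(2\alpha)}+\|x\|_p\bigr)^{-2\alpha-4}.$$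 (ii) For every $x\in\mathbb{Q}_p^4$, $Z(x,\cdot)\in C^1((0,\infty),\mathbb{R})$, and for all $t>0$ $$\frac{\partial Z(x,t)}{\partial t}=-\kappa\int_{\mathbb{Q}_p^4}|f^{\circ}(\eta)|_p^{\alpha}\,e^{-\kappa t|f^{\circ}(\eta)|_p^{\alpha}}\,\chi(x\cdot\eta)\,d^4\eta ,$$ where the integral converges absolutely. (iii) There is a constant $C_2>0$, depending only on $p,a,\alpha,\kappa$, such that for all $x\in\mathbb{Q}_p^4$ and $t>0$ $$\left|\frac{\partial Z(x,t)}{\partial t}\right|\le C_2\bigl(t^{1/(2\alpha)}+\|x\|_p\bigr)^{-2\alpha-4}.$$ (iv) For every $t>0$: $\int_{\mathbb{Q}_p^4}Z_t(x)\,d^4x=1$, and $Z_t\in L^{\rho}(\mathbb{Q}_p^4)$ for every $1\le\rho\le\infty$. -/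

import Mathlib

noncomputable section

open MeasureTheory

namespace PadicHeat

variable (p : ℕ) [Fact p.Prime]

/-- `ℚ_p` carries its Borel σ-algebra. -/
instance instMeasurableSpacePadic : MeasurableSpace ℚ_[p] := borel ℚ_[p]

instance instBorelSpacePadic : BorelSpace ℚ_[p] := ⟨rfl⟩

/-- The unit ball `B_0^4 = ℤ_p^4` of `ℚ_p^4`, as a compact set with nonempty interior.  The norm
on `Fin 4 → ℚ_[p]` is the maximum of the `p`-adic norms of the coordinates. -/
def unitBall : TopologicalSpace.PositiveCompacts (Fin 4 → ℚ_[p]) where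
  carrier := Metric.closedBall 0 1
  isCompact' := isCompact_closedBall 0 1
  interior_nonempty' :=
    ⟨0, interior_mono Metric.ball_subset_closedBall
      (by rw [Metric.isOpen_ball.interior_eq]; exact Metric.mem_ball_self one_pos)⟩

/-- The Haar measure `d^4x` on `ℚ_p^4`, normalized so that the unit ball has measure `1`. -/
def haar4 : Measure (Fin 4 → ℚ_[p]) := Measure.addHaarMeasure (unitBall p)

variable {p}

/-- The number of digits of `y` in front of the `p`-adic point: `-ord(y)` if `ord(y) < 0`, and `0`
if `y = 0` or `ord(y) ≥ 0`. -/
def poleOrder (y : ℚ_[p]) : ℕ := (-y.valuation).toNat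

theorem norm_pow_poleOrder_mul_le (y : ℚ_[p]) : ‖(p : ℚ_[p]) ^ poleOrder y * y‖ ≤ 1 := by
  rcases eq_or_ne y 0 with rfl | hy
  · simp
  · have hp : (1 : ℝ) < p := by exact_mod_cast (Fact.out : p.Prime).one_lt
    rw [norm_mul, Padic.norm_p_pow, Padic.norm_eq_zpow_neg_valuation hy,
      ← zpow_add₀ (by positivity)]
    refine zpow_le_one_of_nonpos₀ hp.le ?_
    unfold poleOrder
    have := Int.self_le_toNat (-y.valuation)
    omega

/-- The fractional part `{y}_p ∈ ℚ` of a `p`-adic number.  With `n = poleOrder y`, the `p`-adic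
integer `p ^ n * y` has the digits of `y`; `PadicInt.appr z n` is the natural number formed by
the first `n` digits of `z`. -/
def fracPart (y : ℚ_[p]) : ℚ :=
  (PadicInt.appr ⟨(p : ℚ_[p]) ^ poleOrder y * y, norm_pow_poleOrder_mul_le y⟩ (poleOrder y) : ℚ)
    / (p : ℚ) ^ poleOrder y

/-- The additive character `χ(y) = exp(2πi {y}_p)` of `ℚ_p`. -/
def chi (y : ℚ_[p]) : ℂ := Complex.exp (2 * Real.pi * Complex.I * ((fracPart y : ℚ) : ℂ))

/-- The quadratic form `f°(ξ) = a p ξ₁² - p ξ₂² - a ξ₃² + ξ₄²`. -/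
def fCirc (a : ℤ) (ξ : Fin 4 → ℚ_[p]) : ℚ_[p] :=
  (a : ℚ_[p]) * p * ξ 0 ^ 2 - p * ξ 1 ^ 2 - a * ξ 2 ^ 2 + ξ 3 ^ 2

/-- The integrand `χ(ξ·x) exp(-κ t |f°(ξ)|_p^α)` of the heat kernel. -/
def heatIntegrand (a : ℤ) (α κ : ℝ) (x : Fin 4 → ℚ_[p]) (t : ℝ) (ξ : Fin 4 → ℚ_[p]) : ℂ :=
  chi (∑ j, ξ j * x j) * (Real.exp (-κ * t * ‖fCirc a ξ‖ ^ α) : ℂ)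

/-- The heat kernel `Z(x,t) = ∫ χ(ξ·x) exp(-κ t |f°(ξ)|_p^α) d⁴ξ`. -/
def heatKernel (a : ℤ) (α κ : ℝ) (x : Fin 4 → ℚ_[p]) (t : ℝ) : ℂ :=
  ∫ ξ, heatIntegrand a α κ x t ξ ∂(haar4 p)

end PadicHeat

end

noncomputable section

open MeasureTheory

namespace PadicHeat

variable {p : ℕ} [Fact p.Prime]

/-! The form splits as f° = N(ξ₄, ξ₃) - p·N(ξ₂, ξ₁) with N(y, x) = y² - a x². Since a is a
non-residue, |N(y, x)| = max(|x|, |y|)². The two parts of f° have norms of opposite parity as powers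
of p, so they cannot cancel, and ‖ξ‖²/p ≤ |f°(ξ)| ≤ ‖ξ‖² (`le_norm_fCirc`, `norm_fCirc_le`). Hence
|f°| is unchanged by any translation shorter than ‖ξ‖/p (`norm_fCirc_add`).

The lower bound makes the integrals converge and gives the bounds at the scale T = t^{1/(2α)}. For
large ‖x‖, choose u with ‖u‖ ≤ p/‖x‖ and χ(u·x) ≠ 1. A u-invariant function has vanishing Fourier
integral at x, so only the ball of radius R = p²/‖x‖ contributes, even after subtracting a constant
there (`norm_integral_mul_chi_le`). There the integrand is within a multiple of R^{2α} of its value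
at the origin, and the volume R⁴ yields the decay ‖x‖^{-2α-4}.

Time derivatives insert powers of |f°|^α, to which the same estimates apply. Over the ball of radius
p^k, Fubini turns the integral of Z_t into the average of e^{-κt|f°|^α} over the dual ball of radius
p^{-k}, which tends to 1. -/

theorem one_lt_p : (1 : ℝ) < p := by exact_mod_cast (Fact.out : p.Prime).one_lt

theorem p_pos : (0 : ℝ) < p := one_pos.trans one_lt_p

/-! ### The additive character χ. -/

theorem norm_sub_fracPart_le (y : ℚ_[p]) : ‖y - (fracPart y : ℚ)‖ ≤ 1 := by
  have hp0 : (p : ℚ_[p]) ≠ 0 := by exact_mod_cast (Fact.out : p.Prime).ne_zero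
  have hP := p_pos (p := p)
  set n := poleOrder y with hn
  set z : ℤ_[p] := ⟨(p : ℚ_[p]) ^ n * y, norm_pow_poleOrder_mul_le y⟩ with hz
  have h := (PadicInt.norm_le_pow_iff_mem_span_pow _ n).2 (PadicInt.appr_spec n z)
  have hF : ((fracPart y : ℚ) : ℚ_[p]) = (z.appr n : ℚ_[p]) / (p : ℚ_[p]) ^ n := by
    unfold fracPart
    push_cast
    rfl
  have e : y - (fracPart y : ℚ) = ((z - (z.appr n : ℤ_[p]) : ℤ_[p]) : ℚ_[p]) / (p : ℚ_[p]) ^ n := by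
    rw [hF]
    push_cast
    rw [hz]
    field_simp
  rw [e, norm_div, norm_pow, Padic.norm_p, PadicInt.norm_def.symm, inv_pow, div_inv_eq_mul]
  calc _ ≤ (p : ℝ) ^ (-(n : ℤ)) * (p : ℝ) ^ n := by gcongr
    _ = 1 := by rw [zpow_neg, zpow_natCast, inv_mul_cancel₀ (by positivity)]

/-- A rational number with `p`-power denominator that is a `p`-adic integer is an integer. -/
theorem exists_int_of_norm_div_le_one {c : ℤ} {n : ℕ}
    (h : ‖(((c : ℚ) / (p : ℚ) ^ n : ℚ) : ℚ_[p])‖ ≤ 1) : ∃ d : ℤ, (c : ℚ) / (p : ℚ) ^ n = d := by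
  have hP := p_pos (p := p)
  have hp0 : (p : ℚ) ≠ 0 := by exact_mod_cast (Fact.out : p.Prime).ne_zero
  push_cast at h
  rw [norm_div, norm_pow, Padic.norm_p, inv_pow, div_inv_eq_mul] at h
  have h2 : ‖(c : ℚ_[p])‖ ≤ (p : ℝ) ^ (-(n : ℤ)) := by
    rw [zpow_neg, zpow_natCast, ← one_div, le_div_iff₀ (by positivity)]
    exact h
  obtain ⟨d, hd⟩ := (Padic.norm_int_le_pow_iff_dvd c n).1 h2
  refine ⟨d, ?_⟩
  rw [hd]
  push_cast
  field_simp

theorem fracPart_eq_div (y : ℚ_[p]) : ∃ (c : ℤ) (n : ℕ), fracPart y = (c : ℚ) / (p : ℚ) ^ n :=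
  ⟨_, _, by unfold fracPart; rfl⟩

/-- Two elements of ℤ[1/p] congruent to y modulo ℤ_p differ by an ordinary integer, so χ may be
computed from either. This frees later arguments from the particular choice made by `fracPart`. -/
theorem chi_eq_exp {y : ℚ_[p]} {c : ℤ} {n : ℕ}
    (h : ‖y - (((c : ℚ) / (p : ℚ) ^ n : ℚ) : ℚ_[p])‖ ≤ 1) :
    chi y = Complex.exp (2 * Real.pi * Complex.I * (((c : ℚ) / (p : ℚ) ^ n : ℚ) : ℂ)) := by
  have hp0 : (p : ℚ) ≠ 0 := by exact_mod_cast (Fact.out : p.Prime).ne_zero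
  obtain ⟨m, k, hm⟩ := fracPart_eq_div y
  have e : fracPart y - (c : ℚ) / (p : ℚ) ^ n
      = ((m * p ^ n - c * p ^ k : ℤ) : ℚ) / (p : ℚ) ^ (k + n) := by
    rw [hm]
    push_cast
    rw [pow_add]
    field_simp
  have h1 : ‖((fracPart y - (c : ℚ) / (p : ℚ) ^ n : ℚ) : ℚ_[p])‖ ≤ 1 := by
    have : ((fracPart y - (c : ℚ) / (p : ℚ) ^ n : ℚ) : ℚ_[p])
        = (y - (((c : ℚ) / (p : ℚ) ^ n : ℚ) : ℚ_[p])) - (y - (fracPart y : ℚ)) := by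
      rw [Rat.cast_sub]; ring
    rw [this, sub_eq_add_neg]
    refine (Padic.nonarchimedean _ _).trans (max_le h ?_)
    rw [norm_neg]
    exact norm_sub_fracPart_le y
  rw [e] at h1
  obtain ⟨d, hd⟩ := exists_int_of_norm_div_le_one h1
  rw [← e, sub_eq_iff_eq_add] at hd
  unfold chi
  rw [hd, Complex.exp_eq_exp_iff_exists_int]
  exact ⟨d, by push_cast; ring⟩

theorem chi_eq_one {y : ℚ_[p]} (h : ‖y‖ ≤ 1) : chi y = 1 := by
  have := chi_eq_exp (y := y) (c := 0) (n := 0) (by simpa using h)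
  simpa using this

theorem chi_add (x y : ℚ_[p]) : chi (x + y) = chi x * chi y := by
  have hp0 : (p : ℚ) ≠ 0 := by exact_mod_cast (Fact.out : p.Prime).ne_zero
  obtain ⟨m, k, hm⟩ := fracPart_eq_div x
  obtain ⟨m', k', hm'⟩ := fracPart_eq_div y
  have e : fracPart x + fracPart y
      = ((m * p ^ k' + m' * p ^ k : ℤ) : ℚ) / (p : ℚ) ^ (k + k') := by
    rw [hm, hm']
    push_cast
    rw [pow_add]
    field_simp
  have h : ‖x + y - ((fracPart x + fracPart y : ℚ) : ℚ_[p])‖ ≤ 1 := by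
    have : x + y - ((fracPart x + fracPart y : ℚ) : ℚ_[p])
        = (x - (fracPart x : ℚ)) + (y - (fracPart y : ℚ)) := by
      rw [Rat.cast_add]; ring
    rw [this]
    exact (Padic.nonarchimedean _ _).trans
      (max_le (norm_sub_fracPart_le x) (norm_sub_fracPart_le y))
  rw [e] at h
  rw [chi_eq_exp h, ← e]
  unfold chi
  rw [← Complex.exp_add]
  congr 1
  push_cast
  ring

theorem norm_chi (y : ℚ_[p]) : ‖chi y‖ = 1 := by
  unfold chi
  have : (2 * Real.pi * Complex.I * ((fracPart y : ℚ) : ℂ))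
      = ((2 * Real.pi * (fracPart y : ℚ) : ℝ) : ℂ) * Complex.I := by push_cast; ring
  rw [this, Complex.norm_exp_ofReal_mul_I]

theorem chi_neg (y : ℚ_[p]) : chi (-y) = starRingEnd ℂ (chi y) := by
  have h : chi y * chi (-y) = 1 := by
    rw [← chi_add, add_neg_cancel]
    exact chi_eq_one (by simp)
  rw [← Complex.inv_eq_conj (norm_chi y)]
  exact eq_inv_of_mul_eq_one_right h

theorem chi_inv_p_ne_one : chi ((p : ℚ_[p])⁻¹) ≠ 1 := by
  have hp := (Fact.out : p.Prime)
  have hp0 : (p : ℂ) ≠ 0 := by exact_mod_cast hp.ne_zero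
  rw [chi_eq_exp (c := 1) (n := 1) (by simp)]
  have h := Complex.isPrimitiveRoot_exp p hp.ne_zero
  have e : 2 * Real.pi * Complex.I * ((((1 : ℤ) : ℚ) / (p : ℚ) ^ 1 : ℚ) : ℂ)
      = 2 * Real.pi * Complex.I / p := by
    push_cast; field_simp
  rw [e]
  exact h.ne_one hp.one_lt

theorem continuous_chi : Continuous (chi : ℚ_[p] → ℂ) := by
  refine IsLocallyConstant.continuous ((IsLocallyConstant.iff_exists_open _).2 fun x => ?_)
  refine ⟨Metric.ball x 1, Metric.isOpen_ball, Metric.mem_ball_self one_pos, fun y hy => ?_⟩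
  have : y = x + (y - x) := by ring
  rw [this, chi_add, chi_eq_one (y := y - x), mul_one]
  exact (mem_ball_iff_norm.1 hy).le

theorem exists_norm_apply_eq (x : Fin 4 → ℚ_[p]) : ∃ i, ‖x i‖ = ‖x‖ := by
  obtain ⟨i, -, hi⟩ := Finset.exists_mem_eq_sup' Finset.univ_nonempty fun i => ‖x i‖
  refine ⟨i, le_antisymm (norm_le_pi_norm x i) ((pi_norm_le_iff_of_nonneg (norm_nonneg _)).2
    fun j => ?_)⟩
  rw [← hi]
  exact Finset.le_sup' (fun i => ‖x i‖) (Finset.mem_univ j)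

/-- A vector of small norm on which the character `ξ ↦ χ(ξ·x)` is nontrivial. -/
theorem exists_chi_ne_one {x : Fin 4 → ℚ_[p]} (hx : x ≠ 0) :
    ∃ u : Fin 4 → ℚ_[p], ‖u‖ ≤ p / ‖x‖ ∧ chi (∑ j, u j * x j) ≠ 1 := by
  obtain ⟨i, hi⟩ := exists_norm_apply_eq x
  have hxi : x i ≠ 0 := by
    rw [← norm_pos_iff, hi]
    exact norm_pos_iff.2 hx
  refine ⟨Pi.single i ((p : ℚ_[p])⁻¹ * (x i)⁻¹), ?_, ?_⟩
  · rw [Pi.norm_single, norm_mul, norm_inv, norm_inv, Padic.norm_p, hi, inv_inv, div_eq_mul_inv]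
  · rw [Finset.sum_eq_single i (fun j _ hj => by simp [hj]) (by simp)]
    rw [Pi.single_eq_same, inv_mul_cancel_right₀ hxi]
    exact chi_inv_p_ne_one

/-! ### Anisotropy of f° and local constancy of its norm. -/

theorem norm_intCast_eq_one {a : ℤ} (ha : ¬ IsSquare (a : ZMod p)) : ‖(a : ℚ_[p])‖ = 1 := by
  refine le_antisymm (Padic.norm_int_le_one a) (not_lt.1 fun h => ha ?_)
  rw [(ZMod.intCast_zmod_eq_zero_iff_dvd a p).2 (Padic.norm_intCast_lt_one_iff.1 h)]
  exact IsSquare.zero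

/-- Otherwise reduction modulo p would exhibit a as a square in the residue field. -/
theorem norm_sq_sub_of_norm_le_one {a : ℤ} (ha : ¬ IsSquare (a : ZMod p)) {z : ℚ_[p]}
    (hz : ‖z‖ ≤ 1) : ‖z ^ 2 - a‖ = 1 := by
  set w : ℤ_[p] := ⟨z, hz⟩ with hw
  have e : z ^ 2 - a = ((w ^ 2 - (a : ℤ_[p]) : ℤ_[p]) : ℚ_[p]) := by push_cast; rfl
  rw [e, ← PadicInt.norm_def]
  refine le_antisymm (PadicInt.norm_le_one _) (not_lt.1 fun h => ha ?_)
  have h2 : w ^ 2 - (a : ℤ_[p]) ∈ RingHom.ker (PadicInt.toZMod (p := p)) := by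
    rw [PadicInt.ker_toZMod]
    exact (PadicInt.mem_nonunits).2 h
  rw [RingHom.mem_ker, map_sub, map_pow, map_intCast, sub_eq_zero] at h2
  exact ⟨PadicInt.toZMod w, by rw [← h2, sq]⟩

/-- The form `y² - a x²` is anisotropic with respect to the maximum norm. -/
theorem norm_sq_sub_mul_sq {a : ℤ} (ha : ¬ IsSquare (a : ZMod p)) (x y : ℚ_[p]) :
    ‖y ^ 2 - a * x ^ 2‖ = max ‖x‖ ‖y‖ ^ 2 := by
  have h1 := norm_intCast_eq_one ha
  rcases le_or_gt ‖y‖ ‖x‖ with h | h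
  · rw [max_eq_left h]
    rcases eq_or_ne x 0 with rfl | hx
    · have : y = 0 := by simpa using h
      simp [this]
    · have e : y ^ 2 - a * x ^ 2 = x ^ 2 * ((y / x) ^ 2 - a) := by field_simp
      rw [e, norm_mul, norm_sq_sub_of_norm_le_one ha, norm_pow, mul_one]
      rw [norm_div]
      exact div_le_one_of_le₀ h (norm_nonneg _)
  · rw [max_eq_right h.le]
    have hlt : ‖(a : ℚ_[p]) * x ^ 2‖ < ‖y ^ 2‖ := by
      rw [norm_mul, h1, one_mul, norm_pow, norm_pow]
      exact pow_lt_pow_left₀ h (norm_nonneg _) two_ne_zero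
    rw [sub_eq_add_neg, Padic.add_eq_max_of_ne (by rw [norm_neg]; exact hlt.ne'), norm_neg,
      max_eq_left hlt.le, norm_pow]

/-- The value group is discrete: nonzero norms are integral powers of p. -/
theorem norm_le_div_of_lt {x y : ℚ_[p]} (h : ‖x‖ < ‖y‖) : ‖x‖ ≤ ‖y‖ / p := by
  have hy : y ≠ 0 := norm_pos_iff.1 ((norm_nonneg x).trans_lt h)
  rw [Padic.norm_eq_zpow_neg_valuation hy] at h ⊢
  rw [Padic.norm_lt_pow_iff_norm_le_pow_sub_one] at h
  rwa [zpow_sub_one₀ p_pos.ne'] at h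

theorem norm_pi_four (ξ : Fin 4 → ℚ_[p]) :
    ‖ξ‖ = max (max ‖ξ 1‖ ‖ξ 0‖) (max ‖ξ 2‖ ‖ξ 3‖) := by
  refine le_antisymm ((pi_norm_le_iff_of_nonneg (by positivity)).2 fun i => ?_) ?_
  · fin_cases i <;> simp
  · simp [norm_le_pi_norm]

theorem fCirc_eq (a : ℤ) (ξ : Fin 4 → ℚ_[p]) :
    fCirc a ξ = (ξ 3 ^ 2 - a * ξ 2 ^ 2) + (-p) * (ξ 1 ^ 2 - a * ξ 0 ^ 2) := by
  unfold fCirc; ring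

/-- The two parts have norms N² and M²/p. If M ≤ N with N ≠ 0, the first strictly dominates; if N <
M, discreteness gives N ≤ M/p and the second does. Either way the ultrametric inequality is an
equality. -/
theorem le_norm_fCirc {a : ℤ} (ha : ¬ IsSquare (a : ZMod p)) (ξ : Fin 4 → ℚ_[p]) :
    ‖ξ‖ ^ 2 / p ≤ ‖fCirc a ξ‖ := by
  have hp := one_lt_p (p := p)
  have hp0 := p_pos (p := p)
  have hA : ‖ξ 3 ^ 2 - a * ξ 2 ^ 2‖ = max ‖ξ 2‖ ‖ξ 3‖ ^ 2 := norm_sq_sub_mul_sq ha _ _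
  have hB : ‖(-p : ℚ_[p]) * (ξ 1 ^ 2 - a * ξ 0 ^ 2)‖ = max ‖ξ 1‖ ‖ξ 0‖ ^ 2 / p := by
    rw [norm_mul, norm_neg, Padic.norm_p, norm_sq_sub_mul_sq ha, max_comm ‖ξ 0‖, inv_mul_eq_div]
  set M := max ‖ξ 1‖ ‖ξ 0‖ with hM
  set N := max ‖ξ 2‖ ‖ξ 3‖ with hN
  have hM0 : 0 ≤ M := by positivity
  have hN0 : 0 ≤ N := by positivity
  have hn : ‖ξ‖ = max M N := norm_pi_four ξ
  rw [hn, fCirc_eq]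
  rcases le_or_gt M N with h | h
  · rw [max_eq_right h]
    rcases hN0.eq_or_lt with h0 | h0
    · rw [← h0]; simp
    have hlt : M ^ 2 / p < N ^ 2 := by
      rw [div_lt_iff₀ hp0]
      have : M ^ 2 ≤ N ^ 2 := by gcongr
      nlinarith [pow_pos h0 2]
    rw [Padic.add_eq_max_of_ne (by rw [hA, hB]; exact hlt.ne'), hA, hB, max_eq_left hlt.le]
    exact div_le_self (by positivity) hp.le
  · rw [max_eq_left h.le]
    have h0 : 0 < M := hN0.trans_lt h
    have hNM : N ≤ M / p := by
      obtain ⟨i, hi⟩ : ∃ i, M = ‖ξ i‖ := by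
        rcases max_choice ‖ξ 1‖ ‖ξ 0‖ with h | h
        exacts [⟨1, h⟩, ⟨0, h⟩]
      obtain ⟨j, hj⟩ : ∃ i, N = ‖ξ i‖ := by
        rcases max_choice ‖ξ 2‖ ‖ξ 3‖ with h | h
        exacts [⟨2, h⟩, ⟨3, h⟩]
      rw [hi, hj] at h ⊢
      exact norm_le_div_of_lt h
    have hlt : N ^ 2 < M ^ 2 / p := by
      calc N ^ 2 ≤ (M / p) ^ 2 := by gcongr
        _ = M ^ 2 / p / p := by ring
        _ < M ^ 2 / p := div_lt_self (by positivity) hp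
    rw [Padic.add_eq_max_of_ne (by rw [hA, hB]; exact hlt.ne), hA, hB, max_eq_right hlt.le]

/-- The form is diagonal with p-integral coefficients, and (ξᵢ + uᵢ)² - ξᵢ² = uᵢ(2ξᵢ + uᵢ). Taking u
= -ξ later gives the upper bound on |f°|. -/
theorem norm_fCirc_add_sub_le (a : ℤ) (ξ u : Fin 4 → ℚ_[p]) (h : ‖u‖ ≤ ‖ξ‖) :
    ‖fCirc a (ξ + u) - fCirc a ξ‖ ≤ ‖ξ‖ * ‖u‖ := by
  have hterm : ∀ (c : ℚ_[p]) (i : Fin 4), ‖c‖ ≤ 1 → ‖c * (u i * (2 * ξ i + u i))‖ ≤ ‖ξ‖ * ‖u‖ := by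
    intro c i hc
    have h2 : ‖(2 : ℚ_[p]) * ξ i‖ ≤ ‖ξ‖ := by
      rw [norm_mul]
      have : ‖(2 : ℚ_[p])‖ ≤ 1 := by exact_mod_cast Padic.norm_int_le_one (p := p) 2
      calc _ ≤ 1 * ‖ξ‖ := by gcongr; exact norm_le_pi_norm ξ i
        _ = ‖ξ‖ := one_mul _
    have h3 : ‖(2 : ℚ_[p]) * ξ i + u i‖ ≤ ‖ξ‖ :=
      (Padic.nonarchimedean _ _).trans (max_le h2 ((norm_le_pi_norm u i).trans h))
    rw [norm_mul, norm_mul]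
    calc _ ≤ 1 * (‖u‖ * ‖ξ‖) := by gcongr; exact norm_le_pi_norm u i
      _ = _ := by ring
  have ha : ‖(a : ℚ_[p])‖ ≤ 1 := Padic.norm_int_le_one a
  have hp : ‖(p : ℚ_[p])‖ ≤ 1 := by exact_mod_cast Padic.norm_int_le_one (p := p) p
  have e : fCirc a (ξ + u) - fCirc a ξ
      = ((a * p * (u 0 * (2 * ξ 0 + u 0)) + (-p) * (u 1 * (2 * ξ 1 + u 1)))
        + (-a) * (u 2 * (2 * ξ 2 + u 2))) + 1 * (u 3 * (2 * ξ 3 + u 3)) := by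
    unfold fCirc
    simp only [Pi.add_apply]
    ring
  rw [e]
  refine (Padic.nonarchimedean _ _).trans (max_le ?_ (hterm _ _ (by simp)))
  refine (Padic.nonarchimedean _ _).trans (max_le ?_ (hterm _ _ (by rwa [norm_neg])))
  refine (Padic.nonarchimedean _ _).trans (max_le (hterm _ _ ?_)
    (hterm _ _ (by rwa [norm_neg])))
  rw [norm_mul]
  exact mul_le_one₀ ha (norm_nonneg _) hp

theorem norm_fCirc_le (a : ℤ) (ξ : Fin 4 → ℚ_[p]) : ‖fCirc a ξ‖ ≤ ‖ξ‖ ^ 2 := by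
  have h := norm_fCirc_add_sub_le a ξ (-ξ) (by simp)
  have h0 : fCirc a (0 : Fin 4 → ℚ_[p]) = 0 := by simp [fCirc]
  rw [add_neg_cancel, h0, zero_sub, norm_neg, norm_neg, ← sq] at h
  exact h

/-- `|f°|` is invariant under translation by vectors that are much shorter. -/
theorem norm_fCirc_add {a : ℤ} (ha : ¬ IsSquare (a : ZMod p)) {ξ u : Fin 4 → ℚ_[p]}
    (h : ‖u‖ < ‖ξ‖ / p) : ‖fCirc a (ξ + u)‖ = ‖fCirc a ξ‖ := by
  have hp := one_lt_p (p := p)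
  have hξ : 0 < ‖ξ‖ := by
    by_contra h0
    have : ‖ξ‖ = 0 := le_antisymm (not_lt.1 h0) (norm_nonneg _)
    rw [this, zero_div] at h
    exact absurd h (not_lt.2 (norm_nonneg _))
  -- The increment is below ‖ξ‖²/p, hence below |f°(ξ)|, and cannot change the norm.
  have h1 : ‖fCirc a (ξ + u) - fCirc a ξ‖ < ‖fCirc a ξ‖ := by
    refine (norm_fCirc_add_sub_le a ξ u (h.le.trans (div_le_self hξ.le hp.le))).trans_lt
      (lt_of_lt_of_le ?_ (le_norm_fCirc ha ξ))
    calc ‖ξ‖ * ‖u‖ < ‖ξ‖ * (‖ξ‖ / p) := by gcongr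
      _ = ‖ξ‖ ^ 2 / p := by ring
  have := Padic.add_eq_max_of_ne (p := p) h1.ne
  rw [sub_add_cancel, max_eq_right h1.le] at this
  exact this

theorem continuous_fCirc (a : ℤ) : Continuous (fCirc a : (Fin 4 → ℚ_[p]) → ℚ_[p]) := by
  unfold fCirc
  fun_prop

theorem fCirc_neg (a : ℤ) (ξ : Fin 4 → ℚ_[p]) : fCirc a (-ξ) = fCirc a ξ := by
  simp [fCirc]

/-! ### Haar measure of balls. -/

instance : (haar4 p).IsAddHaarMeasure := Measure.isAddHaarMeasure_addHaarMeasure (unitBall p)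

theorem exists_norm_sub_natCast_lt_one {y : ℚ_[p]} (hy : ‖y‖ ≤ 1) :
    ∃ r : Fin p, ‖y - ((r : ℕ) : ℚ_[p])‖ < 1 := by
  set w : ℤ_[p] := ⟨y, hy⟩ with hw
  obtain ⟨n, hn, h⟩ := PadicInt.exists_mem_range w
  have h1 : ‖w - (n : ℤ_[p])‖ < 1 := PadicInt.mem_nonunits.1 h
  rw [PadicInt.norm_def] at h1
  push_cast at h1
  exact ⟨⟨n, hn⟩, h1⟩

theorem eq_of_norm_natCast_sub_lt_one {r s : Fin p}
    (h : ‖((r : ℕ) : ℚ_[p]) - ((s : ℕ) : ℚ_[p])‖ < 1) : r = s := by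
  have h1 : ‖(((r : ℕ) - (s : ℕ) : ℤ) : ℚ_[p])‖ < 1 := by push_cast; exact h
  have h2 := Padic.norm_intCast_lt_one_iff.1 h1
  have h3 : ((r : ℕ) : ℤ) - (s : ℕ) = 0 := by
    refine Int.eq_zero_of_abs_lt_dvd h2 ?_
    have := r.2; have := s.2
    rw [abs_lt]; constructor <;> omega
  exact Fin.ext (by omega)

/-- Splitting by the leading digit of each coordinate partitions the larger ball into p⁴ translates
of the smaller one. -/
theorem haar4_closedBall_succ (k : ℤ) :
    haar4 p (Metric.closedBall 0 ((p : ℝ) ^ (k + 1)))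
      = (p : ENNReal) ^ 4 * haar4 p (Metric.closedBall 0 ((p : ℝ) ^ k)) := by
  have hP := p_pos (p := p)
  have hp0 : (p : ℚ_[p]) ≠ 0 := by exact_mod_cast (Fact.out : p.Prime).ne_zero
  set c : (Fin 4 → Fin p) → (Fin 4 → ℚ_[p]) :=
    fun r i => (p : ℚ_[p]) ^ (-(k + 1)) * ((r i : ℕ) : ℚ_[p]) with hc
  have hnp : ‖(p : ℚ_[p]) ^ (-(k + 1))‖ = (p : ℝ) ^ (k + 1) := by
    rw [Padic.norm_p_zpow, neg_neg]
  -- By discreteness the closed ball of radius p^k is the open ball of radius p^(k+1); rescaling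
  -- makes it an open unit ball, that is, a residue class modulo p.
  have key : ∀ y z : ℚ_[p], ‖y - (p : ℚ_[p]) ^ (-(k + 1)) * z‖ ≤ (p : ℝ) ^ k
      ↔ ‖(p : ℚ_[p]) ^ (k + 1) * y - z‖ < 1 := by
    intro y z
    have e : y - (p : ℚ_[p]) ^ (-(k + 1)) * z
        = (p : ℚ_[p]) ^ (-(k + 1)) * ((p : ℚ_[p]) ^ (k + 1) * y - z) := by
      rw [mul_sub, ← mul_assoc, ← zpow_add₀ hp0]; simp
    rw [Padic.norm_le_pow_iff_norm_lt_pow_add_one, e, norm_mul, hnp]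
    exact mul_lt_iff_lt_one_right (by positivity)
  have hU : Metric.closedBall (0 : Fin 4 → ℚ_[p]) ((p : ℝ) ^ (k + 1))
      = ⋃ r : Fin 4 → Fin p, Metric.closedBall (c r) ((p : ℝ) ^ k) := by
    ext y
    simp only [Set.mem_iUnion, mem_closedBall_iff_norm, sub_zero]
    constructor
    · intro hy
      have : ∀ i, ∃ r : Fin p, ‖(p : ℚ_[p]) ^ (k + 1) * y i - ((r : ℕ) : ℚ_[p])‖ < 1 := by
        intro i
        refine exists_norm_sub_natCast_lt_one ?_
        rw [norm_mul, Padic.norm_p_zpow]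
        calc _ ≤ (p : ℝ) ^ (-(k + 1)) * (p : ℝ) ^ (k + 1) := by
              gcongr; exact (norm_le_pi_norm y i).trans hy
          _ = 1 := by rw [← zpow_add₀ hP.ne']; simp
      choose r hr using this
      exact ⟨r, (pi_norm_le_iff_of_nonneg (by positivity)).2 fun i => (key _ _).2 (hr i)⟩
    · rintro ⟨r, hr⟩
      have h2 : ‖c r‖ ≤ (p : ℝ) ^ (k + 1) := by
        refine (pi_norm_le_iff_of_nonneg (by positivity)).2 fun i => ?_
        rw [hc, norm_mul, hnp]
        refine mul_le_of_le_one_right (by positivity) ?_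
        exact_mod_cast Padic.norm_int_le_one (p := p) ((r i : ℕ) : ℤ)
      have h3 : ‖y - c r‖ ≤ (p : ℝ) ^ (k + 1) :=
        hr.trans (zpow_le_zpow_right₀ one_lt_p.le (by omega))
      have := IsUltrametricDist.norm_add_le_max (y - c r) (c r)
      rw [sub_add_cancel] at this
      exact this.trans (max_le h3 h2)
  have hd : Pairwise (Function.onFun Disjoint
      fun r : Fin 4 → Fin p => Metric.closedBall (c r) ((p : ℝ) ^ k)) := by
    intro r s hrs
    refine Set.disjoint_left.2 fun y hr hs => hrs (funext fun i => ?_)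
    rw [mem_closedBall_iff_norm, pi_norm_le_iff_of_nonneg (by positivity)] at hr hs
    have h1 := (key _ _).1 (hr i)
    have h2 := (key _ _).1 (hs i)
    refine eq_of_norm_natCast_sub_lt_one (p := p) ?_
    have e : ((r i : ℕ) : ℚ_[p]) - ((s i : ℕ) : ℚ_[p])
        = ((p : ℚ_[p]) ^ (k + 1) * y i - ((s i : ℕ) : ℚ_[p]))
          + -((p : ℚ_[p]) ^ (k + 1) * y i - ((r i : ℕ) : ℚ_[p])) := by ring
    rw [e]
    exact (Padic.nonarchimedean _ _).trans_lt (max_lt h2 (by rwa [norm_neg]))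
  rw [hU, measure_iUnion hd fun _ => Metric.isClosed_closedBall.measurableSet]
  have ht : ∀ r, haar4 p (Metric.closedBall (c r) ((p : ℝ) ^ k))
      = haar4 p (Metric.closedBall 0 ((p : ℝ) ^ k)) := by
    intro r
    rw [← measure_preimage_add_right (haar4 p) (c r) (Metric.closedBall (c r) _)]
    congr 1
    ext y
    simp
  simp_rw [ht]
  rw [tsum_fintype, Finset.sum_const, Finset.card_univ, nsmul_eq_mul]
  simp

theorem haar4_closedBall (k : ℤ) :
    haar4 p (Metric.closedBall 0 ((p : ℝ) ^ k)) = ENNReal.ofReal (((p : ℝ) ^ k) ^ 4) := by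
  have hP := p_pos (p := p)
  have hs : ∀ k : ℤ, ENNReal.ofReal (((p : ℝ) ^ (k + 1)) ^ 4)
      = (p : ENNReal) ^ 4 * ENNReal.ofReal (((p : ℝ) ^ k) ^ 4) := by
    intro k
    rw [zpow_add_one₀ hP.ne', mul_pow, mul_comm, ENNReal.ofReal_mul (by positivity),
      ENNReal.ofReal_pow hP.le, ENNReal.ofReal_natCast]
  have hp4 : (p : ENNReal) ^ 4 ≠ 0 := by
    have := (Fact.out : p.Prime).ne_zero
    positivity
  have hp4' : (p : ENNReal) ^ 4 ≠ ⊤ := by finiteness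
  induction k using Int.induction_on with
  | zero =>
    simp only [zpow_zero, one_pow, ENNReal.ofReal_one]
    exact Measure.addHaarMeasure_self (K₀ := unitBall p)
  | succ n ih => rw [haar4_closedBall_succ, ih, hs]
  | pred n ih =>
    have h1 := haar4_closedBall_succ (p := p) (-(n : ℤ) - 1)
    have h2 := hs (-(n : ℤ) - 1)
    rw [sub_add_cancel] at h1 h2
    rw [ih, h2] at h1
    exact ((ENNReal.mul_right_inj hp4 hp4').1 h1).symm

theorem exists_norm_eq_zpow {x : Fin 4 → ℚ_[p]} (hx : x ≠ 0) : ∃ k : ℤ, ‖x‖ = (p : ℝ) ^ k := by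
  obtain ⟨i, hi⟩ := exists_norm_apply_eq x
  have hxi : x i ≠ 0 := by
    rw [← norm_pos_iff, hi]
    exact norm_pos_iff.2 hx
  exact ⟨_, by rw [← hi, Padic.norm_eq_zpow_neg_valuation hxi]⟩

/-! ### Radial integrals and power bounds for exponentials. -/

theorem continuous_add_norm_rpow {S : ℝ} (hS : 0 < S) (β : ℝ) :
    Continuous fun ξ : Fin 4 → ℚ_[p] => (S + ‖ξ‖) ^ (-β) :=
  (continuous_const.add continuous_norm).rpow_const fun ξ =>
    Or.inl (add_pos_of_pos_of_nonneg hS (norm_nonneg ξ)).ne'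

/-- A single term of the sum already dominates. Using nested balls instead of shells overcounts, but
needs only the volumes of balls. -/
theorem ofReal_add_norm_rpow_le_tsum {S β : ℝ} (hβ : 0 < β) {k : ℤ} (hS : (p : ℝ) ^ k ≤ S)
    (ξ : Fin 4 → ℚ_[p]) :
    ENNReal.ofReal ((S + ‖ξ‖) ^ (-β)) ≤
      ∑' i : ℕ, (Metric.closedBall 0 ((p : ℝ) ^ (k + i))).indicator
        (fun _ => ENNReal.ofReal (((p : ℝ) ^ (k + i)) ^ (-β))) ξ := by
  have hP := p_pos (p := p)
  have hS0 : 0 < S := lt_of_lt_of_le (by positivity) hS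
  obtain ⟨i, hi1, hi2⟩ : ∃ i : ℕ, ‖ξ‖ ≤ (p : ℝ) ^ (k + i) ∧ (p : ℝ) ^ (k + i) ≤ S + ‖ξ‖ := by
    rcases le_or_gt ‖ξ‖ ((p : ℝ) ^ k) with h | h
    · exact ⟨0, by simpa using h, by simpa using hS.trans (le_add_of_nonneg_right (norm_nonneg _))⟩
    · have hξ : ξ ≠ 0 := by
        rintro rfl
        rw [norm_zero] at h
        exact absurd h (not_lt.2 (by positivity))
      obtain ⟨m, hm⟩ := exists_norm_eq_zpow hξ
      rw [hm, zpow_lt_zpow_iff_right₀ one_lt_p] at h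
      have e : k + ((m - k).toNat : ℤ) = m := by omega
      exact ⟨(m - k).toNat, by rw [e, hm], by rw [e, hm]; linarith⟩
  refine le_trans ?_ (ENNReal.le_tsum i)
  rw [Set.indicator_of_mem (by simpa using hi1)]
  exact ENNReal.ofReal_le_ofReal
    (Real.rpow_le_rpow_of_nonpos (by positivity) hi2 (neg_nonpos.2 hβ.le))

/-- Volume p^{4(k+i)} times height p^{-β(k+i)} is geometric in i, with ratio p^{4-β} < 1 because β >
4. -/
theorem lintegral_add_norm_rpow_le {S β : ℝ} (hβ : 4 < β) {k : ℤ} (hS : (p : ℝ) ^ k ≤ S) :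
    ∫⁻ ξ : Fin 4 → ℚ_[p], ENNReal.ofReal ((S + ‖ξ‖) ^ (-β)) ∂(haar4 p)
      ≤ ENNReal.ofReal (((p : ℝ) ^ k) ^ (4 - β) * (1 - (p : ℝ) ^ (4 - β))⁻¹) := by
  have hP := p_pos (p := p)
  have hr0 : 0 ≤ (p : ℝ) ^ (4 - β) := by positivity
  have hr1 : (p : ℝ) ^ (4 - β) < 1 := Real.rpow_lt_one_of_one_lt_of_neg one_lt_p (by linarith)
  have hterm : ∀ i : ℕ, ENNReal.ofReal (((p : ℝ) ^ (k + i)) ^ (-β))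
      * haar4 p (Metric.closedBall 0 ((p : ℝ) ^ (k + i)))
      = ENNReal.ofReal (((p : ℝ) ^ k) ^ (4 - β) * ((p : ℝ) ^ (4 - β)) ^ i) := by
    intro i
    rw [haar4_closedBall, ← ENNReal.ofReal_mul (by positivity)]
    congr 1
    rw [← Real.rpow_natCast _ 4, ← Real.rpow_add (by positivity), zpow_add₀ hP.ne', zpow_natCast,
      Real.mul_rpow (by positivity) (by positivity), ← Real.rpow_natCast_mul hP.le,
      ← Real.rpow_mul_natCast hP.le]
    push_cast
    ring_nf
  calc _ ≤ ∫⁻ ξ : Fin 4 → ℚ_[p], ∑' i : ℕ, (Metric.closedBall 0 ((p : ℝ) ^ (k + i))).indicator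
          (fun _ => ENNReal.ofReal (((p : ℝ) ^ (k + i)) ^ (-β))) ξ ∂(haar4 p) :=
        lintegral_mono (ofReal_add_norm_rpow_le_tsum (by linarith) hS)
    _ = ∑' i : ℕ, ENNReal.ofReal (((p : ℝ) ^ k) ^ (4 - β) * ((p : ℝ) ^ (4 - β)) ^ i) := by
        rw [lintegral_tsum fun i => (measurable_const.indicator
          Metric.isClosed_closedBall.measurableSet).aemeasurable]
        refine tsum_congr fun i => ?_
        rw [lintegral_indicator_const Metric.isClosed_closedBall.measurableSet, hterm]
    _ = _ := by
        rw [← ENNReal.ofReal_tsum_of_nonneg (fun i => by positivity)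
          ((summable_geometric_of_lt_one hr0 hr1).mul_left _), tsum_mul_left,
          tsum_geometric_of_lt_one hr0 hr1]

theorem integrable_add_norm_rpow {S β : ℝ} (hS : 0 < S) (hβ : 4 < β) :
    Integrable (fun ξ : Fin 4 → ℚ_[p] => (S + ‖ξ‖) ^ (-β)) (haar4 p) := by
  obtain ⟨k, hk, -⟩ := exists_mem_Ico_zpow hS (one_lt_p (p := p))
  refine ⟨(continuous_add_norm_rpow hS β).aestronglyMeasurable, ?_⟩
  rw [hasFiniteIntegral_iff_ofReal (Filter.Eventually.of_forall fun ξ => by positivity)]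
  exact (lintegral_add_norm_rpow_le hβ hk).trans_lt ENNReal.ofReal_lt_top

variable (p) in
theorem exists_integral_add_norm_rpow_le {β : ℝ} (hβ : 4 < β) : ∃ D : ℝ, 0 < D ∧ ∀ S : ℝ, 0 < S →
    ∫ ξ : Fin 4 → ℚ_[p], (S + ‖ξ‖) ^ (-β) ∂(haar4 p) ≤ D * S ^ (4 - β) := by
  have hP := p_pos (p := p)
  have hr1 : (p : ℝ) ^ (4 - β) < 1 := Real.rpow_lt_one_of_one_lt_of_neg one_lt_p (by linarith)
  have hr2 : 0 < (1 - (p : ℝ) ^ (4 - β))⁻¹ := inv_pos.2 (by linarith)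
  refine ⟨((p : ℝ)⁻¹) ^ (4 - β) * (1 - (p : ℝ) ^ (4 - β))⁻¹, by positivity, fun S hS => ?_⟩
  obtain ⟨k, hk, hk'⟩ := exists_mem_Ico_zpow hS (one_lt_p (p := p))
  rw [integral_eq_lintegral_of_nonneg_ae (Filter.Eventually.of_forall fun ξ => by positivity)
    (continuous_add_norm_rpow hS β).aestronglyMeasurable]
  refine (ENNReal.toReal_le_of_le_ofReal (by positivity)
    (lintegral_add_norm_rpow_le hβ hk)).trans ?_
  -- Rounding S down to a power of p loses at most a factor p, which accounts for (p⁻¹)^(4 - β) in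
  -- the constant.
  have h1 : (p : ℝ)⁻¹ * S ≤ (p : ℝ) ^ k := by
    rw [inv_mul_le_iff₀ hP, mul_comm, ← zpow_add_one₀ hP.ne']
    exact hk'.le
  calc _ ≤ ((p : ℝ)⁻¹ * S) ^ (4 - β) * (1 - (p : ℝ) ^ (4 - β))⁻¹ := by
        gcongr ?_ * _
        exact Real.rpow_le_rpow_of_nonpos (by positivity) h1 (by linarith)
    _ = _ := by
        rw [Real.mul_rpow (by positivity) hS.le]
        ring

/-- Powers are dominated by exponentials. -/
theorem exists_exp_neg_mul_le_rpow {c r : ℝ} (hc : 0 < c) (hr : 0 < r) :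
    ∃ C : ℝ, 1 ≤ C ∧ ∀ z : ℝ, 0 < z → Real.exp (-c * z) ≤ C * z ^ (-r) := by
  -- The maximum with 1 serves `exists_exp_neg_mul_rpow_le`, where the exponential is bounded by 1
  -- for y ≤ 1.
  refine ⟨max 1 (Real.exp (r * Real.log (r / c))), le_max_left _ _, fun z hz => ?_⟩
  calc Real.exp (-c * z) ≤ Real.exp (r * Real.log (r / c)) * z ^ (-r) := by
        rw [Real.rpow_def_of_pos hz, ← Real.exp_add, Real.exp_le_exp]
        have h := Real.log_le_sub_one_of_pos (x := z * (c / r)) (by positivity)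
        have e : Real.log (z * (c / r)) = Real.log z - Real.log (r / c) := by
          rw [Real.log_mul (by positivity) (by positivity), Real.log_div hc.ne' hr.ne',
            Real.log_div hr.ne' hc.ne']
          ring
        rw [e] at h
        have h2 := mul_le_mul_of_nonneg_left h hr.le
        have h3 : r * (z * (c / r) - 1) = c * z - r := by field_simp
        rw [h3] at h2
        nlinarith
    _ ≤ _ := by gcongr; exact le_max_right _ _

theorem exists_exp_neg_mul_rpow_le {c γ β : ℝ} (hc : 0 < c) (hγ : 0 < γ) (hβ : 0 < β) :
    ∃ C : ℝ, 0 < C ∧ ∀ y : ℝ, 0 ≤ y → Real.exp (-c * y ^ γ) ≤ C * (1 + y) ^ (-β) := by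
  obtain ⟨C, hC, h⟩ := exists_exp_neg_mul_le_rpow hc (div_pos hβ hγ)
  -- The factor 2^β comes from 1 + y ≤ 2 max(1, y).
  refine ⟨C * 2 ^ β, by positivity, fun y hy => ?_⟩
  have h2 : ∀ w : ℝ, 0 < w → 1 + y ≤ 2 * w → w ^ (-β) ≤ 2 ^ β * (1 + y) ^ (-β) := by
    intro w hw hyw
    have := Real.rpow_le_rpow_of_nonpos (by positivity) hyw (neg_nonpos.2 hβ.le)
    rw [Real.mul_rpow two_pos.le hw.le, Real.rpow_neg two_pos.le] at this
    rwa [← inv_mul_le_iff₀ (by positivity)]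
  rw [mul_assoc]
  rcases le_or_gt y 1 with hy1 | hy1
  · have := h2 1 one_pos (by linarith)
    rw [Real.one_rpow] at this
    calc _ ≤ (1 : ℝ) := Real.exp_le_one_iff.2 (by
          have : 0 ≤ c * y ^ γ := by positivity
          linarith)
      _ ≤ C * 1 := by linarith
      _ ≤ _ := by gcongr
  · have hy0 : 0 < y := by linarith
    calc _ ≤ C * (y ^ γ) ^ (-(β / γ)) := h _ (by positivity)
      _ = C * y ^ (-β) := by
          rw [← Real.rpow_mul hy0.le]
          congr 2
          field_simp
      _ ≤ _ := by gcongr; exact h2 y hy0 (by linarith)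

/-! ### Radial majorants of exp(-κt|f°|^α). -/

theorem rpow_le_rpow_norm_fCirc {a : ℤ} (ha : ¬ IsSquare (a : ZMod p)) {α : ℝ} (hα : 0 < α)
    (ξ : Fin 4 → ℚ_[p]) : (p : ℝ) ^ (-α) * ‖ξ‖ ^ (2 * α) ≤ ‖fCirc a ξ‖ ^ α := by
  have hP := p_pos (p := p)
  calc _ = (‖ξ‖ ^ 2 / p) ^ α := by
        rw [Real.div_rpow (by positivity) hP.le, Real.rpow_neg hP.le, inv_mul_eq_div,
          Real.rpow_mul (norm_nonneg _), Real.rpow_two]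
    _ ≤ _ := by gcongr; exact le_norm_fCirc ha ξ

theorem rpow_norm_fCirc_le (a : ℤ) {α : ℝ} (hα : 0 < α) (ξ : Fin 4 → ℚ_[p]) :
    ‖fCirc a ξ‖ ^ α ≤ ‖ξ‖ ^ (2 * α) := by
  rw [Real.rpow_mul (norm_nonneg _), Real.rpow_two]
  gcongr
  exact norm_fCirc_le a ξ

/-- With S = t^{-1/(2α)}, anisotropy gives t|f°(ξ)|^α ≥ p^{-α}(‖ξ‖/S)^{2α}, so a bound in the single
variable ‖ξ‖/S is uniform in t. -/
theorem exists_exp_fCirc_le {a : ℤ} (ha : ¬ IsSquare (a : ZMod p)) {α κ β : ℝ} (hα : 0 < α)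
    (hκ : 0 < κ) (hβ : 0 < β) : ∃ C : ℝ, 0 < C ∧ ∀ t : ℝ, 0 < t → ∀ ξ : Fin 4 → ℚ_[p],
      Real.exp (-κ * t * ‖fCirc a ξ‖ ^ α) ≤
        C * (t ^ (-(1 / (2 * α)))) ^ β * (t ^ (-(1 / (2 * α))) + ‖ξ‖) ^ (-β) := by
  have hP := p_pos (p := p)
  obtain ⟨C, hC, h⟩ := exists_exp_neg_mul_rpow_le (c := κ * (p : ℝ) ^ (-α)) (γ := 2 * α) (β := β)
    (by positivity) (by positivity) hβ
  refine ⟨C, hC, fun t ht ξ => ?_⟩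
  set S := t ^ (-(1 / (2 * α))) with hS
  have hS0 : 0 < S := by positivity
  have hSt : S ^ (2 * α) = t⁻¹ := by
    rw [hS, ← Real.rpow_mul ht.le, ← Real.rpow_neg_one]
    congr 1
    field_simp
  calc _ ≤ Real.exp (-(κ * (p : ℝ) ^ (-α)) * (‖ξ‖ / S) ^ (2 * α)) := by
        rw [Real.exp_le_exp, Real.div_rpow (norm_nonneg _) hS0.le, hSt, div_inv_eq_mul]
        have := mul_le_mul_of_nonneg_left (rpow_le_rpow_norm_fCirc ha hα ξ)
          (show 0 ≤ κ * t by positivity)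
        linarith
    _ ≤ C * (1 + ‖ξ‖ / S) ^ (-β) := h _ (by positivity)
    _ = C * ((S + ‖ξ‖) / S) ^ (-β) := by
        congr 2; field_simp
    _ = _ := by
        rw [Real.div_rpow (by positivity) hS0.le, Real.rpow_neg hS0.le, div_inv_eq_mul]
        ring

theorem continuous_rpow_norm_fCirc (a : ℤ) {α : ℝ} (hα : 0 < α) :
    Continuous fun ξ : Fin 4 → ℚ_[p] => ‖fCirc a ξ‖ ^ α :=
  (continuous_fCirc a).norm.rpow_const fun _ => Or.inr hα.le

theorem integrable_exp_fCirc {a : ℤ} (ha : ¬ IsSquare (a : ZMod p)) {α κ : ℝ} (hα : 0 < α)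
    (hκ : 0 < κ) {t : ℝ} (ht : 0 < t) :
    Integrable (fun ξ : Fin 4 → ℚ_[p] => Real.exp (-κ * t * ‖fCirc a ξ‖ ^ α)) (haar4 p) := by
  obtain ⟨C, -, h⟩ := exists_exp_fCirc_le ha (β := 5) hα hκ (by norm_num)
  refine ((integrable_add_norm_rpow (p := p) (S := t ^ (-(1 / (2 * α)))) (β := 5) (by positivity)
    (by norm_num)).const_mul (C * (t ^ (-(1 / (2 * α)))) ^ (5 : ℝ))).mono' ?_
    (Filter.Eventually.of_forall fun ξ => ?_)
  · exact (Real.continuous_exp.comp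
      (continuous_const.mul (continuous_rpow_norm_fCirc a hα))).aestronglyMeasurable
  · rw [Real.norm_of_nonneg (Real.exp_pos _).le]
    exact h t ht ξ

theorem exists_integral_exp_fCirc_le {a : ℤ} (ha : ¬ IsSquare (a : ZMod p)) {α κ : ℝ} (hα : 0 < α)
    (hκ : 0 < κ) : ∃ C : ℝ, 0 < C ∧ ∀ t : ℝ, 0 < t →
      ∫ ξ : Fin 4 → ℚ_[p], Real.exp (-κ * t * ‖fCirc a ξ‖ ^ α) ∂(haar4 p)
        ≤ C * (t ^ (1 / (2 * α))) ^ (-4 : ℝ) := by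
  -- Any exponent above 4 would do: it cancels in S^5 · S^(4 - 5) = S^(5 - 1).
  obtain ⟨C, hC, h⟩ := exists_exp_fCirc_le ha (β := 5) hα hκ (by norm_num)
  obtain ⟨D, hD, h'⟩ := exists_integral_add_norm_rpow_le p (β := 5) (by norm_num)
  refine ⟨C * D, by positivity, fun t ht => ?_⟩
  set S := t ^ (-(1 / (2 * α))) with hS
  have hS0 : 0 < S := by positivity
  have hT : t ^ (1 / (2 * α)) = S⁻¹ := by rw [hS, Real.rpow_neg ht.le, inv_inv]
  calc _ ≤ ∫ ξ : Fin 4 → ℚ_[p], C * S ^ (5 : ℝ) * (S + ‖ξ‖) ^ (-5 : ℝ) ∂(haar4 p) :=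
        integral_mono (integrable_exp_fCirc ha hα hκ ht)
          ((integrable_add_norm_rpow hS0 (by norm_num)).const_mul _) (h t ht)
    _ ≤ C * S ^ (5 : ℝ) * (D * S ^ (4 - 5 : ℝ)) := by
        rw [integral_const_mul]
        gcongr
        exact h' S hS0
    _ = C * D * S ^ (4 : ℝ) := by
        rw [show (4 : ℝ) = 5 + (4 - 5) by norm_num, Real.rpow_add hS0]
        ring_nf
    _ = _ := by
        rw [hT, Real.inv_rpow hS0.le, Real.rpow_neg hS0.le, inv_inv]

/-- Two competing bounds combine into one for the sum of the scales. -/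
theorem le_mul_add_rpow_of_le {A K K' T s β : ℝ} (hT : 0 < T) (hs : 0 ≤ s) (hβ : 0 < β)
    (hK : 0 < K) (h1 : A ≤ K * T ^ (-β)) (h2 : 0 < s → A ≤ K' * s ^ (-β)) :
    A ≤ max K K' * 2 ^ β * (T + s) ^ (-β) := by
  have key : ∀ w : ℝ, 0 < w → T + s ≤ 2 * w → w ^ (-β) ≤ 2 ^ β * (T + s) ^ (-β) := by
    intro w hw hyw
    have := Real.rpow_le_rpow_of_nonpos (by positivity) hyw (neg_nonpos.2 hβ.le)
    rw [Real.mul_rpow two_pos.le hw.le, Real.rpow_neg two_pos.le] at this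
    rwa [← inv_mul_le_iff₀ (by positivity)]
  rw [mul_assoc]
  rcases le_or_gt s T with h | h
  · refine h1.trans (mul_le_mul (le_max_left _ _) (key T hT (by linarith)) (by positivity)
      (by positivity))
  · have hs0 := hT.trans h
    refine (h2 hs0).trans (mul_le_mul (le_max_right _ _) (key s hs0 (by linarith)) (by positivity)
      (by positivity))

/-! ### Decay of Fourier integrals. -/

theorem integrable_mul_chi {F : (Fin 4 → ℚ_[p]) → ℂ} {μ : Measure (Fin 4 → ℚ_[p])}
    (hF : Integrable F μ) (x : Fin 4 → ℚ_[p]) :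
    Integrable (fun ξ => F ξ * chi (∑ j, ξ j * x j)) μ :=
  have h : Continuous fun ξ : Fin 4 → ℚ_[p] => chi (∑ j, ξ j * x j) :=
    continuous_chi.comp (by fun_prop)
  hF.mul_bdd (c := 1) h.aestronglyMeasurable (Filter.Eventually.of_forall fun _ => (norm_chi _).le)

/-- A function invariant under a translation on which the character is nontrivial has zero
Fourier coefficient. -/
theorem integral_mul_chi_eq_zero {g : (Fin 4 → ℚ_[p]) → ℂ} {x u : Fin 4 → ℚ_[p]}
    (hg : ∀ ξ, g (ξ + u) = g ξ) (hu : chi (∑ j, u j * x j) ≠ 1) :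
    ∫ ξ, g ξ * chi (∑ j, ξ j * x j) ∂(haar4 p) = 0 := by
  -- Translation by u preserves the integral but also multiplies it by χ(u·x) ≠ 1.
  have h := integral_add_right_eq_self (μ := haar4 p) (fun ξ => g ξ * chi (∑ j, ξ j * x j)) u
  have e : ∀ ξ : Fin 4 → ℚ_[p], g (ξ + u) * chi (∑ j, (ξ + u) j * x j)
      = chi (∑ j, u j * x j) * (g ξ * chi (∑ j, ξ j * x j)) := by
    intro ξ
    simp only [hg, Pi.add_apply, add_mul, Finset.sum_add_distrib, chi_add]
    ring
  simp_rw [e] at h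
  rw [integral_const_mul] at h
  by_contra h0
  exact hu (mul_right_cancel₀ h0 (by rw [h, one_mul]))

theorem norm_add_le_iff {ξ u : Fin 4 → ℚ_[p]} {R : ℝ} (hu : ‖u‖ ≤ R) :
    ‖ξ + u‖ ≤ R ↔ ‖ξ‖ ≤ R := by
  constructor <;> intro h
  · have := IsUltrametricDist.norm_add_le_max (ξ + u) (-u)
    rw [add_neg_cancel_right, norm_neg] at this
    exact this.trans (max_le h hu)
  · exact (IsUltrametricDist.norm_add_le_max ξ u).trans (max_le h hu)

theorem haar4_real_closedBall (k : ℤ) :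
    (haar4 p).real (Metric.closedBall 0 ((p : ℝ) ^ k)) = ((p : ℝ) ^ k) ^ 4 := by
  have := p_pos (p := p)
  rw [Measure.real, haar4_closedBall, ENNReal.toReal_ofReal (by positivity)]

theorem haar4_closedBall_lt_top (k : ℤ) :
    haar4 p (Metric.closedBall 0 ((p : ℝ) ^ k)) < ⊤ := by
  rw [haar4_closedBall]
  exact ENNReal.ofReal_lt_top

/-- Decay of the Fourier transform of a function that is invariant under short translations. -/
theorem norm_integral_mul_chi_le {F : (Fin 4 → ℚ_[p]) → ℂ} (hF : Integrable F (haar4 p))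
    (hinv : ∀ ξ u : Fin 4 → ℚ_[p], ‖u‖ < ‖ξ‖ / p → F (ξ + u) = F ξ) {x : Fin 4 → ℚ_[p]}
    (hx : x ≠ 0) {c : ℂ} {M : ℝ} (hM : ∀ ξ, ‖ξ‖ ≤ p ^ 2 / ‖x‖ → ‖F ξ - c‖ ≤ M) :
    ‖∫ ξ, F ξ * chi (∑ j, ξ j * x j) ∂(haar4 p)‖ ≤ M * ((p : ℝ) ^ 2 / ‖x‖) ^ 4 := by
  have hP := p_pos (p := p)
  have hx0 : 0 < ‖x‖ := norm_pos_iff.2 hx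
  obtain ⟨m, hm⟩ := exists_norm_eq_zpow hx
  have hR : (p : ℝ) ^ 2 / ‖x‖ = (p : ℝ) ^ (2 - m) := by
    rw [hm, zpow_sub₀ hP.ne']; rfl
  obtain ⟨u, hu, hu1⟩ := exists_chi_ne_one hx
  have huR : ‖u‖ ≤ (p : ℝ) ^ 2 / ‖x‖ / p := by
    refine hu.trans_eq ?_
    field_simp
  -- Since ‖u‖ ≤ R/p, every ξ with ‖ξ‖ > R satisfies ‖u‖ < ‖ξ‖/p, as `hinv` requires.
  set R := (p : ℝ) ^ 2 / ‖x‖ with hRdef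
  have huR' : ‖u‖ ≤ R := huR.trans (div_le_self (by positivity) one_lt_p.le)
  set B := Metric.closedBall (0 : Fin 4 → ℚ_[p]) R with hB
  have hBm : MeasurableSet B := Metric.isClosed_closedBall.measurableSet
  have hBfin : haar4 p B < ⊤ := by rw [hB, hR]; exact haar4_closedBall_lt_top _
  have hmem : ∀ ξ, ξ ∈ B ↔ ‖ξ‖ ≤ R := fun ξ => mem_closedBall_zero_iff
  -- F - D is the constant c on B and equals F elsewhere. As B is stable under translation by u, F -
  -- D is u-invariant and only D contributes.
  set D := B.indicator fun ξ => F ξ - c with hD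
  have hDint : Integrable D (haar4 p) :=
    (integrable_indicator_iff hBm).2 (hF.integrableOn.sub (integrableOn_const hBfin.ne))
  have hz : ∫ ξ, (F ξ - D ξ) * chi (∑ j, ξ j * x j) ∂(haar4 p) = 0 := by
    refine integral_mul_chi_eq_zero (u := u) (fun ξ => ?_) hu1
    by_cases h : ξ ∈ B
    · have h' : ξ + u ∈ B := by
        rw [hmem] at h ⊢
        exact (norm_add_le_iff huR').2 h
      simp [hD, h, h']
    · have h' : ξ + u ∉ B := by
        rw [hmem] at h ⊢
        rwa [norm_add_le_iff huR']
      rw [hD, Set.indicator_of_notMem h, Set.indicator_of_notMem h', sub_zero, sub_zero]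
      rw [hmem, not_le] at h
      exact hinv ξ u (huR.trans_lt (by gcongr))
  simp_rw [sub_mul] at hz
  rw [integral_sub (integrable_mul_chi hF x) (integrable_mul_chi hDint x), sub_eq_zero] at hz
  rw [hz]
  have e : ∀ ξ, D ξ * chi (∑ j, ξ j * x j)
      = B.indicator (fun ξ => (F ξ - c) * chi (∑ j, ξ j * x j)) ξ := by
    intro ξ
    by_cases h : ξ ∈ B <;> simp [hD, h]
  simp_rw [e]
  rw [integral_indicator hBm]
  refine (norm_setIntegral_le_of_norm_le_const hBfin (C := M) fun ξ hξ => ?_).trans_eq ?_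
  · rw [norm_mul, norm_chi, mul_one]
    exact hM ξ ((hmem ξ).1 hξ)
  · rw [hB, hR, haar4_real_closedBall]

/-! ### Moment integrals and differentiation in time. -/

/-- The integrand of the time derivatives of the heat kernel. -/
def momentIntegrand (a : ℤ) (α κ : ℝ) (x : Fin 4 → ℚ_[p]) (n : ℕ) (t : ℝ)
    (ξ : Fin 4 → ℚ_[p]) : ℂ :=
  (((‖fCirc a ξ‖ ^ α) ^ n * Real.exp (-κ * t * ‖fCirc a ξ‖ ^ α) : ℝ) : ℂ)
    * chi (∑ j, ξ j * x j)

theorem heatIntegrand_eq (a : ℤ) (α κ : ℝ) (x : Fin 4 → ℚ_[p]) (t : ℝ) :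
    heatIntegrand a α κ x t = momentIntegrand a α κ x 0 t := by
  funext ξ
  simp [heatIntegrand, momentIntegrand, mul_comm]

theorem norm_momentIntegrand (a : ℤ) (α κ : ℝ) (x : Fin 4 → ℚ_[p]) (n : ℕ) (t : ℝ)
    (ξ : Fin 4 → ℚ_[p]) : ‖momentIntegrand a α κ x n t ξ‖
      = (‖fCirc a ξ‖ ^ α) ^ n * Real.exp (-κ * t * ‖fCirc a ξ‖ ^ α) := by
  rw [momentIntegrand, norm_mul, norm_chi, mul_one, Complex.norm_real,
    Real.norm_of_nonneg (by positivity)]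

/-- Half of the exponential absorbs wⁿ, through zⁿ/n! ≤ e^z at z = κtw/2. -/
theorem pow_mul_exp_le {κ t w : ℝ} (hκ : 0 < κ) (ht : 0 < t) (hw : 0 ≤ w) (n : ℕ) :
    w ^ n * Real.exp (-κ * t * w)
      ≤ n.factorial * (2 / (κ * t)) ^ n * Real.exp (-κ * (t / 2) * w) := by
  have h := Real.pow_div_factorial_le_exp (κ * t / 2 * w) (by positivity) n
  have hf : (0 : ℝ) < n.factorial := by exact_mod_cast n.factorial_pos
  rw [div_le_iff₀ hf] at h
  have e : Real.exp (-κ * (t / 2) * w)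
      = Real.exp (κ * t / 2 * w) * Real.exp (-κ * t * w) := by
    rw [← Real.exp_add]; congr 1; ring
  have e2 : w ^ n = (2 / (κ * t)) ^ n * (κ * t / 2 * w) ^ n := by
    rw [← mul_pow]; congr 1; field_simp
  rw [e, e2]
  calc _ ≤ (2 / (κ * t)) ^ n * (Real.exp (κ * t / 2 * w) * n.factorial)
        * Real.exp (-κ * t * w) := by gcongr
    _ = _ := by ring

theorem continuous_moment (a : ℤ) {α : ℝ} (hα : 0 < α) (κ t : ℝ) (n : ℕ) :
    Continuous fun ξ : Fin 4 → ℚ_[p] =>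
      (‖fCirc a ξ‖ ^ α) ^ n * Real.exp (-κ * t * ‖fCirc a ξ‖ ^ α) :=
  have h := continuous_rpow_norm_fCirc (p := p) a hα
  (h.pow n).mul (Real.continuous_exp.comp (continuous_const.mul h))

theorem integrable_moment {a : ℤ} (ha : ¬ IsSquare (a : ZMod p)) {α κ : ℝ} (hα : 0 < α)
    (hκ : 0 < κ) {t : ℝ} (ht : 0 < t) (n : ℕ) :
    Integrable (fun ξ : Fin 4 → ℚ_[p] =>
      (‖fCirc a ξ‖ ^ α) ^ n * Real.exp (-κ * t * ‖fCirc a ξ‖ ^ α)) (haar4 p) := by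
  refine ((integrable_exp_fCirc ha hα hκ (half_pos ht)).const_mul
    (n.factorial * (2 / (κ * t)) ^ n)).mono' (continuous_moment a hα κ t n).aestronglyMeasurable
    (Filter.Eventually.of_forall fun ξ => ?_)
  rw [Real.norm_of_nonneg (by positivity)]
  exact pow_mul_exp_le hκ ht (by positivity) n

theorem integrable_momentIntegrand {a : ℤ} (ha : ¬ IsSquare (a : ZMod p)) {α κ : ℝ} (hα : 0 < α)
    (hκ : 0 < κ) (x : Fin 4 → ℚ_[p]) (n : ℕ) {t : ℝ} (ht : 0 < t) :
    Integrable (momentIntegrand a α κ x n t) (haar4 p) :=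
  integrable_mul_chi (integrable_moment ha hα hκ ht n).ofReal x

/-- The case n = 0 gives the time derivative of the kernel; n = 1 gives continuity of that
derivative. For s > t/2 the integrand at time t/2 dominates. -/
theorem hasDerivAt_integral_momentIntegrand {a : ℤ} (ha : ¬ IsSquare (a : ZMod p)) {α κ : ℝ}
    (hα : 0 < α) (hκ : 0 < κ) (x : Fin 4 → ℚ_[p]) (n : ℕ) {t : ℝ} (ht : 0 < t) :
    HasDerivAt (fun s => ∫ ξ, momentIntegrand a α κ x n s ξ ∂(haar4 p))
      (-(κ : ℂ) * ∫ ξ, momentIntegrand a α κ x (n + 1) t ξ ∂(haar4 p)) t := by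
  rw [← integral_const_mul]
  refine (hasDerivAt_integral_of_dominated_loc_of_deriv_le (μ := haar4 p) (x₀ := t)
    (s := Set.Ioi (t / 2)) (F := momentIntegrand a α κ x n)
    (F' := fun s ξ => -(κ : ℂ) * momentIntegrand a α κ x (n + 1) s ξ)
    (bound := fun ξ => κ * ((‖fCirc a ξ‖ ^ α) ^ (n + 1)
      * Real.exp (-κ * (t / 2) * ‖fCirc a ξ‖ ^ α)))
    (Ioi_mem_nhds (half_lt_self ht)) ?_ (integrable_momentIntegrand ha hα hκ x n ht)
    ((integrable_momentIntegrand ha hα hκ x (n + 1) ht).const_mul _).aestronglyMeasurable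
    (Filter.Eventually.of_forall fun ξ s hs => ?_)
    ((integrable_moment ha hα hκ (half_pos ht) (n + 1)).const_mul κ)
    (Filter.Eventually.of_forall fun ξ s _ => ?_)).2
  · filter_upwards [Ioi_mem_nhds ht] with s hs
    exact (integrable_momentIntegrand ha hα hκ x n hs).aestronglyMeasurable
  · rw [norm_mul, norm_neg, Complex.norm_real, Real.norm_of_nonneg hκ.le, norm_momentIntegrand]
    have hs' : t / 2 ≤ s := (Set.mem_Ioi.1 hs).le
    have h2 := mul_le_mul_of_nonneg_left hs' (mul_nonneg hκ.le
      (show 0 ≤ ‖fCirc a ξ‖ ^ α by positivity))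
    exact mul_le_mul_of_nonneg_left (mul_le_mul_of_nonneg_left (Real.exp_le_exp.2 (by linarith))
      (by positivity)) hκ.le
  · have h1 : HasDerivAt (fun s : ℝ => (‖fCirc a ξ‖ ^ α) ^ n
        * Real.exp (-κ * s * ‖fCirc a ξ‖ ^ α))
        (-κ * ((‖fCirc a ξ‖ ^ α) ^ (n + 1) * Real.exp (-κ * s * ‖fCirc a ξ‖ ^ α))) s := by
      have h0 : HasDerivAt (fun s : ℝ => -κ * s * ‖fCirc a ξ‖ ^ α) (-κ * ‖fCirc a ξ‖ ^ α) s := by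
        simpa using ((hasDerivAt_id s).const_mul (-κ)).mul_const (‖fCirc a ξ‖ ^ α)
      refine (h0.exp.const_mul _).congr_deriv ?_
      ring
    refine (h1.ofReal_comp.mul_const (chi (∑ j, ξ j * x j))).congr_deriv ?_
    simp only [momentIntegrand]
    push_cast
    ring

/-! ### Reality and pointwise bounds. -/

theorem heatKernel_eq (a : ℤ) (α κ : ℝ) (x : Fin 4 → ℚ_[p]) (t : ℝ) :
    heatKernel a α κ x t = ∫ ξ, momentIntegrand a α κ x 0 t ξ ∂(haar4 p) := by
  rw [heatKernel, heatIntegrand_eq]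

/-- Complex conjugation amounts to ξ ↦ -ξ, which preserves both f° and Haar measure. -/
theorem heatKernel_im (a : ℤ) (α κ : ℝ) (x : Fin 4 → ℚ_[p]) (t : ℝ) :
    (heatKernel a α κ x t).im = 0 := by
  rw [← Complex.conj_eq_iff_im, heatKernel, ← integral_conj,
    ← integral_neg_eq_self (μ := haar4 p) (heatIntegrand a α κ x t)]
  congr 1
  funext ξ
  simp only [heatIntegrand, fCirc_neg, map_mul, Complex.conj_ofReal, ← chi_neg, Pi.neg_apply,
    neg_mul, Finset.sum_neg_distrib]

theorem norm_integral_momentIntegrand_le {a : ℤ} {α κ : ℝ}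
    (x : Fin 4 → ℚ_[p]) (n : ℕ) (t : ℝ) :
    ‖∫ ξ, momentIntegrand a α κ x n t ξ ∂(haar4 p)‖ ≤
      ∫ ξ : Fin 4 → ℚ_[p], (‖fCirc a ξ‖ ^ α) ^ n
        * Real.exp (-κ * t * ‖fCirc a ξ‖ ^ α) ∂(haar4 p) :=
  (norm_integral_le_integral_norm _).trans_eq (by simp_rw [norm_momentIntegrand])

/-- Large-distance bound for the Fourier transforms of functions of `|f°|`. -/
theorem norm_integral_momentIntegrand_le_of_ne_zero {a : ℤ} (ha : ¬ IsSquare (a : ZMod p))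
    {α κ : ℝ} (hα : 0 < α) (hκ : 0 < κ) {x : Fin 4 → ℚ_[p]} (hx : x ≠ 0) (n : ℕ) {t : ℝ}
    (ht : 0 < t) (c : ℝ) {M : ℝ} (hM0 : 0 ≤ M)
    (hM : ∀ w : ℝ, 0 ≤ w → |w ^ n * Real.exp (-κ * t * w) - c| ≤ M * w) :
    ‖∫ ξ, momentIntegrand a α κ x n t ξ ∂(haar4 p)‖
      ≤ M * (p : ℝ) ^ (2 * (2 * α + 4)) * ‖x‖ ^ (-(2 * α + 4)) := by
  have hP := p_pos (p := p)
  have hx0 : 0 < ‖x‖ := norm_pos_iff.2 hx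
  have hF : Integrable (fun ξ : Fin 4 → ℚ_[p] => (((‖fCirc a ξ‖ ^ α) ^ n
      * Real.exp (-κ * t * ‖fCirc a ξ‖ ^ α) : ℝ) : ℂ)) (haar4 p) :=
    (integrable_moment ha hα hκ ht n).ofReal
  -- On the ball of radius R = p²/‖x‖ one has |f°|^α ≤ R^{2α}; with the volume R⁴ the bound is
  -- M·R^{2α+4}.
  refine (norm_integral_mul_chi_le (c := (c : ℂ)) (M := M * ((p : ℝ) ^ 2 / ‖x‖) ^ (2 * α))
    hF (fun ξ u h => ?_) hx fun ξ hξ => ?_).trans_eq ?_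
  · rw [norm_fCirc_add ha h]
  · rw [← Complex.ofReal_sub, Complex.norm_real, Real.norm_eq_abs]
    refine (hM _ (by positivity)).trans ?_
    gcongr
    exact (rpow_norm_fCirc_le a hα ξ).trans (Real.rpow_le_rpow (norm_nonneg _) hξ (by positivity))
  · have hq : 0 < (p : ℝ) ^ 2 / ‖x‖ := by positivity
    rw [mul_assoc, ← Real.rpow_natCast _ 4, ← Real.rpow_add hq]
    push_cast
    rw [Real.div_rpow (by positivity) hx0.le, Real.rpow_neg hx0.le, Real.rpow_mul hP.le,
      Real.rpow_two]
    ring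

theorem exists_norm_heatKernel_le {a : ℤ} (ha : ¬ IsSquare (a : ZMod p)) {α κ : ℝ} (hα : 0 < α)
    (hκ : 0 < κ) : ∃ C : ℝ, 0 < C ∧ ∀ (x : Fin 4 → ℚ_[p]) (t : ℝ), 0 < t →
      ‖heatKernel a α κ x t‖ ≤ C * t * (t ^ (1 / (2 * α)) + ‖x‖) ^ (-(2 * α + 4)) := by
  have hP := p_pos (p := p)
  obtain ⟨C, hC, h⟩ := exists_integral_exp_fCirc_le ha hα hκ
  refine ⟨max C (κ * (p : ℝ) ^ (2 * (2 * α + 4))) * 2 ^ (2 * α + 4), by positivity,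
    fun x t ht => ?_⟩
  set T := t ^ (1 / (2 * α)) with hT
  have hT0 : 0 < T := by positivity
  have hTt : T ^ (2 * α) = t := by
    rw [hT, ← Real.rpow_mul ht.le]
    field_simp
    exact Real.rpow_one t
  -- After division by t = T^{2α}, the bound T^{-4} on the kernel becomes T^{-(2α+4)}, the same
  -- power as at large distance.
  have key := le_mul_add_rpow_of_le (A := ‖heatKernel a α κ x t‖ / t) (K := C)
    (K' := κ * (p : ℝ) ^ (2 * (2 * α + 4))) (s := ‖x‖) (β := 2 * α + 4) hT0 (norm_nonneg x)
    (by positivity) hC ?_ ?_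
  · rw [div_le_iff₀ ht] at key
    linarith
  · rw [div_le_iff₀ ht, heatKernel_eq]
    refine (norm_integral_momentIntegrand_le x 0 t).trans ?_
    simp only [pow_zero, one_mul]
    refine (h t ht).trans_eq ?_
    rw [mul_assoc, ← hT]
    congr 1
    conv_rhs => rw [← hTt]
    rw [← Real.rpow_add hT0]
    congr 1
    ring
  · intro hs
    rw [div_le_iff₀ ht, heatKernel_eq]
    -- The constant c = 1 is the value of the exponential at w = 0, and 0 ≤ 1 - e^{-κtw} ≤ κtw.
    refine (norm_integral_momentIntegrand_le_of_ne_zero ha hα hκ (norm_pos_iff.1 hs) 0 ht 1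
      (M := κ * t) (by positivity) fun w hw => ?_).trans_eq (by ring)
    have h1 : Real.exp (-κ * t * w) ≤ 1 := Real.exp_le_one_iff.2 (by
      have : 0 ≤ κ * t * w := by positivity
      linarith)
    rw [pow_zero, one_mul, abs_sub_comm, abs_of_nonneg (by linarith)]
    have := Real.add_one_le_exp (-κ * t * w)
    linarith

theorem exists_norm_integral_momentIntegrand_one_le {a : ℤ} (ha : ¬ IsSquare (a : ZMod p))
    {α κ : ℝ} (hα : 0 < α) (hκ : 0 < κ) :
    ∃ C : ℝ, 0 < C ∧ ∀ (x : Fin 4 → ℚ_[p]) (t : ℝ), 0 < t →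
      ‖∫ ξ, momentIntegrand a α κ x 1 t ξ ∂(haar4 p)‖
        ≤ C * (t ^ (1 / (2 * α)) + ‖x‖) ^ (-(2 * α + 4)) := by
  have hP := p_pos (p := p)
  obtain ⟨C, hC, h⟩ := exists_integral_exp_fCirc_le ha hα hκ
  -- The factor 2/κ is the cost of absorbing one power of |f°|^α; the powers of 1/2 come from
  -- evaluating at time t/2.
  set L := (2 / κ) * (C * ((1 / 2 : ℝ) ^ (1 / (2 * α))) ^ (-4 : ℝ)) with hL
  have hL0 : 0 < L := by positivity
  refine ⟨max L (1 * (p : ℝ) ^ (2 * (2 * α + 4))) * 2 ^ (2 * α + 4), by positivity,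
    fun x t ht => ?_⟩
  set T := t ^ (1 / (2 * α)) with hT
  have hT0 : 0 < T := by positivity
  have hTt : T ^ (-(2 * α)) = t⁻¹ := by
    rw [hT, ← Real.rpow_mul ht.le, ← Real.rpow_neg_one]
    congr 1
    field_simp
  refine le_mul_add_rpow_of_le hT0 (norm_nonneg x) (by positivity) hL0 ?_ ?_
  · calc _ ≤ ∫ ξ : Fin 4 → ℚ_[p], (‖fCirc a ξ‖ ^ α) ^ 1
          * Real.exp (-κ * t * ‖fCirc a ξ‖ ^ α) ∂(haar4 p) :=
          norm_integral_momentIntegrand_le x 1 t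
      _ ≤ ∫ ξ : Fin 4 → ℚ_[p], (Nat.factorial 1 * (2 / (κ * t)) ^ 1)
          * Real.exp (-κ * (t / 2) * ‖fCirc a ξ‖ ^ α) ∂(haar4 p) :=
          integral_mono (integrable_moment ha hα hκ ht 1)
            ((integrable_exp_fCirc ha hα hκ (half_pos ht)).const_mul _)
            fun ξ => pow_mul_exp_le hκ ht (by positivity) 1
      _ ≤ (2 / (κ * t)) * (C * ((t / 2) ^ (1 / (2 * α))) ^ (-4 : ℝ)) := by
          rw [integral_const_mul]
          simp only [Nat.factorial_one, Nat.cast_one, one_mul, pow_one]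
          gcongr
          exact h _ (half_pos ht)
      _ = L * (t⁻¹ * T ^ (-4 : ℝ)) := by
          rw [div_eq_mul_one_div t, Real.mul_rpow ht.le (by positivity), ← hT,
            Real.mul_rpow hT0.le (by positivity), hL]
          field_simp
      _ = _ := by
          rw [← hTt, ← Real.rpow_add hT0]
          congr 2
          ring
  · intro hs
    -- The weight w·e^{-κtw} vanishes at w = 0 and is at most w, so c = 0 and M = 1 suffice.
    refine norm_integral_momentIntegrand_le_of_ne_zero ha hα hκ (norm_pos_iff.1 hs) 1 ht 0
      one_pos.le fun w hw => ?_
    rw [sub_zero, abs_of_nonneg (by positivity), pow_one, one_mul]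
    refine mul_le_of_le_one_right hw (Real.exp_le_one_iff.2 ?_)
    have : 0 ≤ κ * t * w := by positivity
    linarith

/-! ### Integrability of the kernel in space. -/

theorem continuous_heatKernel {a : ℤ} (ha : ¬ IsSquare (a : ZMod p)) {α κ : ℝ} (hα : 0 < α)
    (hκ : 0 < κ) {t : ℝ} (ht : 0 < t) :
    Continuous fun x : Fin 4 → ℚ_[p] => heatKernel a α κ x t := by
  simp_rw [heatKernel_eq]
  refine continuous_of_dominated (bound := fun ξ => (‖fCirc a ξ‖ ^ α) ^ 0
      * Real.exp (-κ * t * ‖fCirc a ξ‖ ^ α))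
    (fun x => (integrable_momentIntegrand ha hα hκ x 0 ht).aestronglyMeasurable)
    (fun x => Filter.Eventually.of_forall fun ξ => (norm_momentIntegrand a α κ x 0 t ξ).le)
    (integrable_moment ha hα hκ ht 0) (Filter.Eventually.of_forall fun ξ => ?_)
  have h : Continuous fun x : Fin 4 → ℚ_[p] => chi (∑ j, ξ j * x j) :=
    continuous_chi.comp (by fun_prop)
  simp only [momentIntegrand]
  exact continuous_const.mul h

theorem integrable_heatKernel {a : ℤ} (ha : ¬ IsSquare (a : ZMod p)) {α κ : ℝ} (hα : 0 < α)
    (hκ : 0 < κ) {t : ℝ} (ht : 0 < t) :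
    Integrable (fun x : Fin 4 → ℚ_[p] => heatKernel a α κ x t) (haar4 p) := by
  obtain ⟨C, -, h⟩ := exists_norm_heatKernel_le ha hα hκ
  exact ((integrable_add_norm_rpow (p := p) (S := t ^ (1 / (2 * α))) (β := 2 * α + 4)
    (by positivity) (by linarith)).const_mul (C * t)).mono'
    (continuous_heatKernel ha hα hκ ht).aestronglyMeasurable
    (Filter.Eventually.of_forall fun x => h x t ht)

/-- An integrable bounded function is in every `L^ρ` with `1 ≤ ρ`. -/
theorem memLp_of_integrable_of_bound {X : Type*} [MeasurableSpace X] {μ : Measure X} {f : X → ℂ}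
    (hf : Integrable f μ) {M : ℝ} (hM : ∀ x, ‖f x‖ ≤ M) {ρ : ENNReal} (hρ : 1 ≤ ρ) :
    MemLp f ρ μ := by
  rcases eq_or_ne ρ ⊤ with rfl | htop
  · exact memLp_top_of_bound hf.aestronglyMeasurable M (Filter.Eventually.of_forall hM)
  have h1 : 1 ≤ ρ.toReal := by
    rw [← ENNReal.toReal_one]
    exact ENNReal.toReal_mono htop hρ
  rw [← integrable_norm_rpow_iff hf.aestronglyMeasurable (one_pos.trans_le hρ).ne' htop]
  refine (hf.norm.const_mul (M ^ (ρ.toReal - 1))).mono'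
    (hf.aestronglyMeasurable.norm.aemeasurable.pow_const _).aestronglyMeasurable
    (Filter.Eventually.of_forall fun x => ?_)
  rw [Real.norm_of_nonneg (by positivity)]
  calc ‖f x‖ ^ ρ.toReal = ‖f x‖ ^ (ρ.toReal - 1) * ‖f x‖ := by
        rcases (norm_nonneg (f x)).eq_or_lt with h | h
        · rw [← h, mul_zero, Real.zero_rpow (by linarith)]
        · rw [← Real.rpow_add_one h.ne', sub_add_cancel]
    _ ≤ _ := by
        exact mul_le_mul_of_nonneg_right
          (Real.rpow_le_rpow (norm_nonneg _) (hM x) (by linarith)) (norm_nonneg _)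

theorem memLp_heatKernel {a : ℤ} (ha : ¬ IsSquare (a : ZMod p)) {α κ : ℝ} (hα : 0 < α)
    (hκ : 0 < κ) {t : ℝ} (ht : 0 < t) {ρ : ENNReal} (hρ : 1 ≤ ρ) :
    MemLp (fun x : Fin 4 → ℚ_[p] => heatKernel a α κ x t) ρ (haar4 p) :=
  memLp_of_integrable_of_bound (integrable_heatKernel ha hα hκ ht) (fun x => by
    rw [heatKernel_eq]
    exact norm_integral_momentIntegrand_le x 0 t) hρ

/-! ### Total mass. -/

theorem setIntegral_closedBall_chi (k : ℤ) (ξ : Fin 4 → ℚ_[p]) :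
    ∫ x in Metric.closedBall 0 ((p : ℝ) ^ k), chi (∑ j, ξ j * x j) ∂(haar4 p)
      = (Metric.closedBall 0 ((p : ℝ) ^ (-k))).indicator
          (fun _ => ((((p : ℝ) ^ k) ^ 4 : ℝ) : ℂ)) ξ := by
  have hP := p_pos (p := p)
  set B := Metric.closedBall (0 : Fin 4 → ℚ_[p]) ((p : ℝ) ^ k) with hB
  have hBm : MeasurableSet B := Metric.isClosed_closedBall.measurableSet
  by_cases h : ξ ∈ Metric.closedBall 0 ((p : ℝ) ^ (-k))
  · rw [Set.indicator_of_mem h, mem_closedBall_zero_iff] at *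
    have e : Set.EqOn (fun x => chi (∑ j, ξ j * x j)) (fun _ => (1 : ℂ)) B := by
      intro x hx
      rw [hB, mem_closedBall_zero_iff] at hx
      refine chi_eq_one (IsUltrametricDist.norm_sum_le_of_forall_le_of_nonneg zero_le_one
        fun j _ => ?_)
      rw [norm_mul]
      calc _ ≤ (p : ℝ) ^ (-k) * (p : ℝ) ^ k := by
            gcongr
            exacts [(norm_le_pi_norm ξ j).trans h, (norm_le_pi_norm x j).trans hx]
        _ = 1 := by rw [← zpow_add₀ hP.ne']; simp
    rw [setIntegral_congr_fun hBm e, setIntegral_const, hB, haar4_real_closedBall]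
    simp
  · rw [Set.indicator_of_notMem h, ← integral_indicator hBm]
    rw [mem_closedBall_zero_iff, not_le] at h
    have hξ : ξ ≠ 0 := by
      rintro rfl
      rw [norm_zero] at h
      exact absurd h (not_lt.2 (by positivity))
    obtain ⟨m, hm⟩ := exists_norm_eq_zpow hξ
    obtain ⟨u, hu, hu1⟩ := exists_chi_ne_one hξ
    -- If ‖ξ‖ = p^m exceeds p^(-k), then p/‖ξ‖ = p^(1-m) ≤ p^k, so u lies in the ball, a subgroup on
    -- which the character is therefore nontrivial.
    have huk : ‖u‖ ≤ (p : ℝ) ^ k := by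
      refine hu.trans ?_
      rw [hm, zpow_lt_zpow_iff_right₀ one_lt_p] at h
      rw [hm]
      calc (p : ℝ) / (p : ℝ) ^ m = (p : ℝ) ^ (1 - m) := by rw [zpow_sub₀ hP.ne', zpow_one]
        _ ≤ _ := zpow_le_zpow_right₀ one_lt_p.le (by omega)
    rw [← integral_mul_chi_eq_zero (g := B.indicator fun _ => 1) (x := ξ) (u := u) ?_ hu1]
    · congr 1
      funext x
      by_cases hx : x ∈ B <;> simp [hx, mul_comm]
    · intro x
      have : x + u ∈ B ↔ x ∈ B := by
        rw [hB, mem_closedBall_zero_iff, mem_closedBall_zero_iff]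
        exact norm_add_le_iff huk
      by_cases hx : x ∈ B
      · rw [Set.indicator_of_mem hx, Set.indicator_of_mem (this.2 hx)]
      · rw [Set.indicator_of_notMem hx, Set.indicator_of_notMem (mt this.1 hx)]

theorem setIntegral_heatKernel {a : ℤ} (ha : ¬ IsSquare (a : ZMod p)) {α κ : ℝ} (hα : 0 < α)
    (hκ : 0 < κ) {t : ℝ} (ht : 0 < t) (k : ℤ) :
    ∫ x in Metric.closedBall (0 : Fin 4 → ℚ_[p]) ((p : ℝ) ^ k), heatKernel a α κ x t ∂(haar4 p)
      = ((((p : ℝ) ^ k) ^ 4 : ℝ) : ℂ)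
        * ∫ ξ in Metric.closedBall (0 : Fin 4 → ℚ_[p]) ((p : ℝ) ^ (-k)),
          (Real.exp (-κ * t * ‖fCirc a ξ‖ ^ α) : ℂ) ∂(haar4 p) := by
  have hint : Integrable (fun ξ : Fin 4 → ℚ_[p] =>
      ((Real.exp (-κ * t * ‖fCirc a ξ‖ ^ α) : ℝ) : ℂ)) (haar4 p) :=
    (integrable_exp_fCirc ha hα hκ ht).ofReal
  have : IsFiniteMeasure ((haar4 p).restrict (Metric.closedBall 0 ((p : ℝ) ^ k))) :=
    ⟨by rw [Measure.restrict_apply_univ]; exact haar4_closedBall_lt_top k⟩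
  unfold heatKernel
  rw [integral_integral_swap]
  · simp only [heatIntegrand, integral_mul_const, setIntegral_closedBall_chi]
    rw [← integral_const_mul, ← integral_indicator Metric.isClosed_closedBall.measurableSet]
    congr 1
    funext ξ
    by_cases h : ξ ∈ Metric.closedBall 0 ((p : ℝ) ^ (-k))
    · rw [Set.indicator_of_mem h, Set.indicator_of_mem h]
    · rw [Set.indicator_of_notMem h, Set.indicator_of_notMem h, zero_mul]
  · have hc : Continuous fun q : (Fin 4 → ℚ_[p]) × (Fin 4 → ℚ_[p]) =>
        chi (∑ j, q.2 j * q.1 j) := continuous_chi.comp (by fun_prop)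
    exact Integrable.bdd_mul (c := 1) (hint.comp_snd _) hc.aestronglyMeasurable
      (Filter.Eventually.of_forall fun _ => (norm_chi _).le)

/-- The volumes of the two dual balls multiply to 1, so the integral is an average of e^{-κt|f°|^α}.
Since |f°|^α ≤ p^{-2αk} on the dual ball, no Fourier inversion is needed. -/
theorem norm_setIntegral_heatKernel_sub_one_le {a : ℤ} (ha : ¬ IsSquare (a : ZMod p)) {α κ : ℝ}
    (hα : 0 < α) (hκ : 0 < κ) {t : ℝ} (ht : 0 < t) (k : ℤ) :
    ‖(∫ x in Metric.closedBall (0 : Fin 4 → ℚ_[p]) ((p : ℝ) ^ k),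
        heatKernel a α κ x t ∂(haar4 p)) - 1‖ ≤ κ * t * ((p : ℝ) ^ (-k)) ^ (2 * α) := by
  have hP := p_pos (p := p)
  have hint : Integrable (fun ξ : Fin 4 → ℚ_[p] =>
      ((Real.exp (-κ * t * ‖fCirc a ξ‖ ^ α) : ℝ) : ℂ)) (haar4 p) :=
    (integrable_exp_fCirc ha hα hκ ht).ofReal
  rw [setIntegral_heatKernel ha hα hκ ht]
  set B := Metric.closedBall (0 : Fin 4 → ℚ_[p]) ((p : ℝ) ^ (-k)) with hB
  have hvol : ((p : ℝ) ^ k) ^ 4 * ((p : ℝ) ^ (-k)) ^ 4 = 1 := by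
    rw [← mul_pow, ← zpow_add₀ hP.ne']
    simp
  have e1 : (1 : ℂ) = ((((p : ℝ) ^ k) ^ 4 : ℝ) : ℂ) * ∫ _ξ in B, (1 : ℂ) ∂(haar4 p) := by
    rw [setIntegral_const, hB, haar4_real_closedBall, Complex.real_smul, mul_one,
      ← Complex.ofReal_mul, hvol, Complex.ofReal_one]
  conv_lhs => enter [1, 2]; rw [e1]
  rw [← mul_sub, ← integral_sub hint.integrableOn
    (integrableOn_const (haar4_closedBall_lt_top (-k)).ne), norm_mul, Complex.norm_real,
    Real.norm_of_nonneg (by positivity)]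
  calc _ ≤ ((p : ℝ) ^ k) ^ 4 * ((κ * t * ((p : ℝ) ^ (-k)) ^ (2 * α))
        * (haar4 p).real B) := by
        gcongr
        refine norm_setIntegral_le_of_norm_le_const (haar4_closedBall_lt_top (-k)) fun ξ hξ => ?_
        rw [mem_closedBall_zero_iff] at hξ
        have hw : ‖fCirc a ξ‖ ^ α ≤ ((p : ℝ) ^ (-k)) ^ (2 * α) :=
          (rpow_norm_fCirc_le a hα ξ).trans (Real.rpow_le_rpow (norm_nonneg _) hξ (by positivity))
        have hw0 : 0 ≤ κ * t * ‖fCirc a ξ‖ ^ α := by positivity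
        have h1 : Real.exp (-κ * t * ‖fCirc a ξ‖ ^ α) ≤ 1 := Real.exp_le_one_iff.2 (by linarith)
        have h2 := Real.add_one_le_exp (-κ * t * ‖fCirc a ξ‖ ^ α)
        have h3 := mul_le_mul_of_nonneg_left hw (mul_pos hκ ht).le
        rw [← Complex.ofReal_one, ← Complex.ofReal_sub, Complex.norm_real, Real.norm_eq_abs,
          abs_sub_comm, abs_of_nonneg (by linarith)]
        linarith
    _ = _ := by
        rw [hB, haar4_real_closedBall]
        linear_combination (κ * t * ((p : ℝ) ^ (-k)) ^ (2 * α)) * hvol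

theorem integral_heatKernel {a : ℤ} (ha : ¬ IsSquare (a : ZMod p)) {α κ : ℝ} (hα : 0 < α)
    (hκ : 0 < κ) {t : ℝ} (ht : 0 < t) :
    ∫ x : Fin 4 → ℚ_[p], heatKernel a α κ x t ∂(haar4 p) = 1 := by
  have hP := p_pos (p := p)
  have hcov : AECover (haar4 p) Filter.atTop
      fun n : ℕ => Metric.closedBall (0 : Fin 4 → ℚ_[p]) ((p : ℝ) ^ (n : ℤ)) := by
    refine aecover_closedBall ?_
    simp_rw [zpow_natCast]
    exact tendsto_pow_atTop_atTop_of_one_lt one_lt_p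
  refine tendsto_nhds_unique
    (hcov.integral_tendsto_of_countably_generated (integrable_heatKernel ha hα hκ ht)) ?_
  rw [tendsto_iff_norm_sub_tendsto_zero]
  refine squeeze_zero (fun _ => norm_nonneg _)
    (fun n : ℕ => norm_setIntegral_heatKernel_sub_one_le ha hα hκ ht n) ?_
  have h1 : ∀ n : ℕ, ((p : ℝ) ^ (-(n : ℤ))) ^ (2 * α) = ((p : ℝ) ^ (-(2 * α))) ^ n := by
    intro n
    rw [← Real.rpow_intCast, ← Real.rpow_mul hP.le, ← Real.rpow_mul_natCast hP.le]
    congr 1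
    push_cast
    ring
  simp_rw [h1]
  rw [← mul_zero (κ * t)]
  exact (tendsto_pow_atTop_nhds_zero_of_lt_one (by positivity)
    (Real.rpow_lt_one_of_one_lt_of_neg one_lt_p (by linarith))).const_mul _

/-! ### Regularity in time. -/

theorem hasDerivAt_heatKernel {a : ℤ} (ha : ¬ IsSquare (a : ZMod p)) {α κ : ℝ} (hα : 0 < α)
    (hκ : 0 < κ) (x : Fin 4 → ℚ_[p]) {t : ℝ} (ht : 0 < t) :
    HasDerivAt (fun s : ℝ => heatKernel a α κ x s)
      (-(κ : ℂ) * ∫ ξ, momentIntegrand a α κ x 1 t ξ ∂(haar4 p)) t := by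
  simp_rw [heatKernel_eq]
  exact hasDerivAt_integral_momentIntegrand ha hα hκ x 0 ht

theorem contDiffOn_heatKernel {a : ℤ} (ha : ¬ IsSquare (a : ZMod p)) {α κ : ℝ} (hα : 0 < α)
    (hκ : 0 < κ) (x : Fin 4 → ℚ_[p]) :
    ContDiffOn ℝ 1 (fun t : ℝ => heatKernel a α κ x t) (Set.Ioi 0) := by
  rw [contDiffOn_one_iff_derivWithin (uniqueDiffOn_Ioi 0)]
  refine ⟨fun t ht => (hasDerivAt_heatKernel ha hα hκ x ht).differentiableAt.differentiableWithinAt,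
    ContinuousOn.congr (f := fun t => -(κ : ℂ) * ∫ ξ, momentIntegrand a α κ x 1 t ξ ∂(haar4 p))
      (fun t ht => ?_) fun t ht => ?_⟩
  · exact ((hasDerivAt_integral_momentIntegrand ha hα hκ x 1 ht).continuousAt.const_mul
      _).continuousWithinAt
  · exact (hasDerivAt_heatKernel ha hα hκ x ht).hasDerivWithinAt.derivWithin
      (uniqueDiffOn_Ioi 0 t ht)

theorem momentIntegrand_one (a : ℤ) (α κ : ℝ) (x : Fin 4 → ℚ_[p]) (t : ℝ) :
    (fun η : Fin 4 → ℚ_[p] =>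
      ((‖fCirc a η‖ ^ α * Real.exp (-κ * t * ‖fCirc a η‖ ^ α) : ℝ) : ℂ)
        * chi (∑ j, x j * η j)) = momentIntegrand a α κ x 1 t := by
  funext η
  simp_rw [momentIntegrand, pow_one, mul_comm (x _)]

end PadicHeat

end

theorem proposition2 (p : ℕ) [Fact p.Prime] (hp : p ≠ 2) (a : ℤ) (ha : ¬ IsSquare (a : ZMod p))
    (α κ : ℝ) (hα : 0 < α) (hκ : 0 < κ) :
    -- the kernel is a convergent integral with real values
    (∀ (x : Fin 4 → ℚ_[p]) (t : ℝ), 0 < t →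
      MeasureTheory.Integrable (PadicHeat.heatIntegrand a α κ x t) (PadicHeat.haar4 p) ∧
      (PadicHeat.heatKernel a α κ x t).im = 0) ∧
    -- upper bound
    (∃ C₁ : ℝ, 0 < C₁ ∧ ∀ (x : Fin 4 → ℚ_[p]) (t : ℝ), 0 < t →
      (PadicHeat.heatKernel a α κ x t).re
        ≤ C₁ * t * (t ^ (1 / (2 * α)) + ‖x‖) ^ (-2 * α - 4)) ∧
    -- continuous differentiability in time, and the formula for the time derivative
    (∀ x : Fin 4 → ℚ_[p],
      ContDiffOn ℝ 1 (fun t : ℝ => PadicHeat.heatKernel a α κ x t) (Set.Ioi 0) ∧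
      ∀ t : ℝ, 0 < t →
        MeasureTheory.Integrable (fun η : Fin 4 → ℚ_[p] =>
          ((‖PadicHeat.fCirc a η‖ ^ α
              * Real.exp (-κ * t * ‖PadicHeat.fCirc a η‖ ^ α) : ℝ) : ℂ)
            * PadicHeat.chi (∑ j, x j * η j)) (PadicHeat.haar4 p) ∧
        HasDerivAt (fun s : ℝ => PadicHeat.heatKernel a α κ x s)
          (-(κ : ℂ) * ∫ η : Fin 4 → ℚ_[p],
            ((‖PadicHeat.fCirc a η‖ ^ α
                * Real.exp (-κ * t * ‖PadicHeat.fCirc a η‖ ^ α) : ℝ) : ℂ)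
              * PadicHeat.chi (∑ j, x j * η j) ∂(PadicHeat.haar4 p)) t) ∧
    -- bound for the time derivative
    (∃ C₂ : ℝ, 0 < C₂ ∧ ∀ (x : Fin 4 → ℚ_[p]) (t : ℝ), 0 < t →
      ‖deriv (fun s : ℝ => PadicHeat.heatKernel a α κ x s) t‖
        ≤ C₂ * (t ^ (1 / (2 * α)) + ‖x‖) ^ (-2 * α - 4)) ∧
    -- total mass one, and membership in every `L^ρ`
    (∀ t : ℝ, 0 < t →
      (∫ x : Fin 4 → ℚ_[p], PadicHeat.heatKernel a α κ x t ∂(PadicHeat.haar4 p)) = 1 ∧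
      ∀ ρ : ENNReal, 1 ≤ ρ →
        MeasureTheory.MemLp (fun x : Fin 4 → ℚ_[p] => PadicHeat.heatKernel a α κ x t) ρ
          (PadicHeat.haar4 p)) := by
  have hexp : -2 * α - 4 = -(2 * α + 4) := by ring
  simp_rw [hexp, PadicHeat.momentIntegrand_one]
  refine ⟨fun x t ht => ⟨?_, PadicHeat.heatKernel_im a α κ x t⟩, ?_, fun x =>
    ⟨PadicHeat.contDiffOn_heatKernel ha hα hκ x, fun t ht =>
      ⟨PadicHeat.integrable_momentIntegrand ha hα hκ x 1 ht,
        PadicHeat.hasDerivAt_heatKernel ha hα hκ x ht⟩⟩, ?_, fun t ht =>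
    ⟨PadicHeat.integral_heatKernel ha hα hκ ht, fun ρ hρ =>
      PadicHeat.memLp_heatKernel ha hα hκ ht hρ⟩⟩
  · rw [PadicHeat.heatIntegrand_eq]
    exact PadicHeat.integrable_momentIntegrand ha hα hκ x 0 ht
  · obtain ⟨C, hC, h⟩ := PadicHeat.exists_norm_heatKernel_le ha hα hκ
    exact ⟨C, hC, fun x t ht => (Complex.re_le_norm _).trans (h x t ht)⟩
  · obtain ⟨C, hC, h⟩ := PadicHeat.exists_norm_integral_momentIntegrand_one_le ha hα hκ
    refine ⟨κ * C, by positivity, fun x t ht => ?_⟩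
    rw [(PadicHeat.hasDerivAt_heatKernel ha hα hκ x ht).deriv, norm_mul, norm_neg,
      Complex.norm_real, Real.norm_of_nonneg hκ.le, mul_assoc]
    exact mul_le_mul_of_nonneg_left (h x t ht) hκ.le
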